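/- Notation: $dA=\pi^{-1}dx\,dy$ on $\mathbb{C}$; $\partial=\frac12(\partial_x-i\partial_y)$, $\bar\partial=\frac12(\partial_x+i\partial_y)$, $\Delta=\partial\bar\partial$; $\mathbb{D}(a,\rho)$ is the open disk of centre $a$ and radius $\rho$. For an open set $U\subset\mathbb C$, a function $f$ is $q$-analytic on $U$ if it is continuous on $U$ and $\bar\partial^q f=0$ there in the sense of distributions. Let $Q:\mathbb{C}\to\mathbb{R}$ be continuous, let $z_0\in\mathbb{C}$, and suppose that $Q$ is real-analytic near $z_0$ and $\Delta Q(z_0)>0$. For $q\ge 1$ and real $m\ge1$ let $A^2_{q,mQ}$ be the space of functions $u$ that are $q$-analytic on $\mathbb{C}$ with $\|u\|_m^2=\int_{\mathbb{C}}|u|^2e^{-mQ}\,dA<\infty$. Call $r>0$, together with a function $Q(\cdot,\cdot)$ on $\mathbb{D}(z_0,r)^2$, admissible if: (1) $Q$ is real-analytic on $\mathbb{D}(z_0,r)$ and $\Delta Q>\epsilon$ there for some $\epsilon>0$; (2) $Q(z,w)$ is a polarization of $Q$, i.e. it is analytic in $z$ and anti-analytic in $w$ (holomorphic in $(z,\bar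 w)$), and $Q(z,z)=Q(z)$; (3) $\partial_z\bar\partial_wQ(z,w)\ne0$ and $\bar\partial_w\theta(z,w)\neq0$ for $z,w\in\mathbb{D}(z_0,r)$, where $\theta(z,w)=\frac{Q(w)-Q(z,w)}{w-z}$ for $w\ne z$ and $\theta(z,z)=\partial Q(z)$; (4) $2\operatorname{Re}Q(z,w)-Q(w)-Q(z)\le-\frac12\Delta Q(z_0)|w-z|^2$ for $z,w\in\mathbb{D}(z_0,r)$. Then all sufficiently small $r>0$ are admissible with a suitable polarization. Moreover, let $r$ and $Q(\cdot,\cdot)$ be admissible, let $q\ge1$ be an integer, and for real $m\ge 1$ put \[ R_{q,m}(z,w)=m\sum_{k=0}^{q-1}\frac{q!\,(-1)^k}{(q-1-k)!\,(k+1)!\,k!}(\bar z-\bar w)^k\,\bar\partial_w^k\big(\bar\partial_w\theta\, e^{m(z-w)\theta}\big)e^{-m(z-w)\theta},\qquad z,w\in\mathbb{D}(z_0,r). \] Then $R_{q,m}$ is $q$-analytic in $z$ and real-analytic in $w$ on $\mathbb{D}(z_0,r)$. Finally, let $\chi(w)=\chi_0(|w-z_0|/r)$, where $\chi_0:\mathbb{R}\to[0,\infty)$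 is smooth, equals $1$ on $(-\frac23,\frac23)$ and has (closed) support in $(-1,1)$. Then there are $\delta>0$ and $C>0$, independent of $m$, $u$ and $z$, such that for all real $m\ge1$, all $u\in A^2_{q,mQ}$ and all $z\in\mathbb{D}(z_0,\frac13r)$ the integral below converges absolutely and \[ \Big|u(z)-\int_{\mathbb{D}(z_0,r)}u(w)\chi(w)R_{q,m}(z,w)e^{m(z-w)\theta(z,w)}\,dA(w)\Big|\le C\,\|u\|_m\,e^{mQ(z)/2-\delta m}. \] -/

import Mathlib

open MeasureTheory Set
open scoped ContDiff ComplexConjugate Nat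

noncomputable section

namespace Polyanalytic

/-- The normalized area measure `dA = π⁻¹ dx dy` on the complex plane. -/
def area : Measure ℂ := ENNReal.ofReal Real.pi⁻¹ • volume

/-- The Wirtinger derivative `∂ = (∂_x - i ∂_y) / 2`. -/
def dz (f : ℂ → ℂ) (z : ℂ) : ℂ :=
  (fderiv ℝ f z 1 - Complex.I * fderiv ℝ f z Complex.I) / 2

/-- The Wirtinger derivative `∂̄ = (∂_x + i ∂_y) / 2`. -/
def dbar (f : ℂ → ℂ) (z : ℂ) : ℂ :=
  (fderiv ℝ f z 1 + Complex.I * fderiv ℝ f z Complex.I) / 2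

/-- `Δ = ∂ ∂̄` (one quarter of the usual Laplacian), on real-valued functions. -/
def lap (Q : ℂ → ℝ) (z : ℂ) : ℝ := (dz (dbar fun w => (Q w : ℂ)) z).re

/-- `f` is `q`-analytic on `U`: continuous, with `∂̄^q f = 0` on `U` in the sense of
distributions. -/
def IsPolyanalyticOn (q : ℕ) (f : ℂ → ℂ) (U : Set ℂ) : Prop :=
  ContinuousOn f U ∧
    ∀ g : ℂ → ℂ, ContDiff ℝ ∞ g → HasCompactSupport g → tsupport g ⊆ U →
      ∫ w, f w * (dbar^[q] g) w ∂area = 0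

/-- Membership in `A²_{q,mQ}`, the space of `q`-analytic functions on `ℂ` that are
square-integrable with respect to `e^{-mQ} dA`. -/
def MemA2 (q : ℕ) (m : ℝ) (Q : ℂ → ℝ) (u : ℂ → ℂ) : Prop :=
  IsPolyanalyticOn q u univ ∧
    Integrable (fun w => ‖u w‖ ^ 2 * Real.exp (-m * Q w)) area

/-- The norm of `L²(e^{-mQ})`. -/
def wnorm (m : ℝ) (Q : ℂ → ℝ) (u : ℂ → ℂ) : ℝ :=
  Real.sqrt (∫ w, ‖u w‖ ^ 2 * Real.exp (-m * Q w) ∂area)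

/-- `P` is a polarization of `Q` on `𝔻(z₀, r)`: it is holomorphic in `z` and `w̄` for
`z, w ∈ 𝔻(z₀, r)`, and `P(z, z) = Q(z)`. -/
structure IsPolarization (Q : ℂ → ℝ) (z₀ : ℂ) (r : ℝ) (P : ℂ → ℂ → ℂ) : Prop where
  analytic : AnalyticOnNhd ℂ (fun p : ℂ × ℂ => P p.1 (conj p.2))
    (Metric.ball z₀ r ×ˢ Metric.ball (conj z₀) r)
  diag : ∀ z ∈ Metric.ball z₀ r, P z z = (Q z : ℂ)

/-- The phase function `θ(z,w) = (Q(w) - P(z,w)) / (w - z)`, continued to the diagonal by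
`θ(z,z) = ∂Q(z)`. -/
def phase (Q : ℂ → ℝ) (P : ℂ → ℂ → ℂ) (z w : ℂ) : ℂ :=
  if w = z then dz (fun ζ => (Q ζ : ℂ)) z else ((Q w : ℂ) - P z w) / (w - z)

/-- The conditions that the radius `r` and the polarization `P` are chosen to satisfy. -/
structure IsAdmissible (Q : ℂ → ℝ) (z₀ : ℂ) (r : ℝ) (P : ℂ → ℂ → ℂ) : Prop where
  pos : 0 < r
  analytic : AnalyticOnNhd ℝ Q (Metric.ball z₀ r)
  lap_pos : ∃ ε : ℝ, 0 < ε ∧ ∀ z ∈ Metric.ball z₀ r, ε < lap Q z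
  polar : IsPolarization Q z₀ r P
  mixed_ne : ∀ z ∈ Metric.ball z₀ r, ∀ w ∈ Metric.ball z₀ r,
    dz (fun ζ => dbar (fun η => P ζ η) w) z ≠ 0
  dbar_phase_ne : ∀ z ∈ Metric.ball z₀ r, ∀ w ∈ Metric.ball z₀ r,
    dbar (fun η => phase Q P z η) w ≠ 0
  bound : ∀ z ∈ Metric.ball z₀ r, ∀ w ∈ Metric.ball z₀ r,
    2 * (P z w).re - Q w - Q z ≤ -(1 / 2) * lap Q z₀ * ‖w - z‖ ^ 2

/-- A smooth non-negative cut-off function on the line which is `1` on `(-2/3, 2/3)` and has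
its (closed) support in `(-1, 1)`. -/
structure IsCutoff (χ₀ : ℝ → ℝ) : Prop where
  smooth : ContDiff ℝ ∞ χ₀
  nonneg : ∀ t, 0 ≤ χ₀ t
  eq_one : ∀ t ∈ Ioo (-(2 / 3) : ℝ) (2 / 3), χ₀ t = 1
  support : tsupport χ₀ ⊆ Ioo (-1 : ℝ) 1

/-- The exponential factor `e^{m (z - w) θ(z, w)}`. -/
def expPhase (m : ℝ) (Q : ℂ → ℝ) (P : ℂ → ℂ → ℂ) (z w : ℂ) : ℂ :=
  Complex.exp ((m : ℂ) * (z - w) * phase Q P z w)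

/-- The kernel
`R_{q,m}(z,w) = m ∑_{k=0}^{q-1} q! (-1)^k / ((q-1-k)! (k+1)! k!) (z̄ - w̄)^k
  ∂̄_w^k (∂̄_w θ e^{m(z-w)θ}) e^{-m(z-w)θ}`. -/
def kernelR (q : ℕ) (m : ℝ) (Q : ℂ → ℝ) (P : ℂ → ℂ → ℂ) (z w : ℂ) : ℂ :=
  (m : ℂ) * ∑ k ∈ Finset.range q,
    ((q ! : ℂ) * (-1) ^ k / (((q - 1 - k)! : ℂ) * ((k + 1)! : ℂ) * (k ! : ℂ))) *
      (conj z - conj w) ^ k *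
      (dbar^[k] (fun η => dbar (fun ξ => phase Q P z ξ) η * expPhase m Q P z η)) w *
      Complex.exp (-((m : ℂ) * (z - w) * phase Q P z w))

end Polyanalytic

end

noncomputable section

namespace Polyanalytic

open Filter Topology

/-! ### Calculus of the operator `∂̄` -/

/-! Write $q=n+1$. Up to a constant, $(\bar w-\bar z)^n/(w-z)$ is a fundamental solution of
$\bar\partial^{n+1}$, so pairing a $q$-analytic $u$ with a test function $g$ through it recovers
$u(z)g(z)$; this is `integral_mul_iterate_dbar_div`. Since $u$ is only continuous and solves the
equation in the weak sense, the singular kernel is replaced by the smooth $T_e=(\bar w-\bar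
z)^{n+1}/(|w-z|^2+e)$. In the Leibniz expansion of $\bar\partial^{n+1}(T_eg)$ the term carrying all
derivatives of $T_e$ is an approximate identity as $e\to0$; the other terms converge pointwise off
$z$ and are dominated by an integrable multiple of $1/|w-z|$.

Now take $g=\chi e^{m(z-w)\theta}$, for which $g(z)=1$. Because $m(z-w)$ is holomorphic in $w$, the
kernel times the exponential is exactly $-\frac1{n!}\bar\partial_w^{n+1}\big((\bar w-\bar
z)^ne^{m(z-w)\theta}\big)/(w-z)$ off the diagonal (`kernelR_mul_expPhase`). The only error is
therefore the commutator of $\bar\partial^{n+1}$ with $\chi$ (`sub_integral_eq`). It vanishes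
wherever $\chi$ is locally $0$ or $1$, hence unless $|w-z|\ge r/3$. There condition (4) gives
$|e^{m(z-w)\theta}|\le e^{m(Q(z)-Q(w))/2-cm}$, the derivatives cost at most $m^{n+1}$, half of $cm$
pays for that power, and Cauchy-Schwarz produces $\|u\|_m$.

For the regularity of the kernel, $\theta$ is a difference quotient in the first slot of the
holomorphic function $p(a,b)=Q(a,\bar b)$, so it is a holomorphic function of $(z,w,\bar w)$. The
kernel is then a polynomial in $\bar z$ of degree less than $q$ with coefficients holomorphic in
$z$.

For existence, the Taylor series of $Q$ is complexified to a symmetric holomorphic $p(a,b)$. On a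
small bidisk $\partial_a\partial_bp$ stays close to its central value, whose real part is $\Delta
Q(z_0)$, and mean value estimates turn this one fact into all the lower bounds in the definition of
admissibility. -/

lemma dbar_congr {f g : ℂ → ℂ} {z : ℂ} (h : f =ᶠ[𝓝 z] g) : dbar f z = dbar g z := by
  simp only [dbar, h.fderiv_eq]

lemma dbar_eqOn {f g : ℂ → ℂ} {U : Set ℂ} (hU : IsOpen U) (h : EqOn f g U) :
    EqOn (dbar f) (dbar g) U :=
  fun _ hz => dbar_congr (h.eventuallyEq_of_mem (hU.mem_nhds hz))

lemma iterate_dbar_eqOn {f g : ℂ → ℂ} {U : Set ℂ} (hU : IsOpen U) (h : EqOn f g U) (n : ℕ) :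
    EqOn (dbar^[n] f) (dbar^[n] g) U := by
  induction n with
  | zero => exact h
  | succ n ih =>
    simp only [Function.iterate_succ_apply']
    exact dbar_eqOn hU ih

lemma dbar_add {f g : ℂ → ℂ} {z : ℂ} (hf : DifferentiableAt ℝ f z)
    (hg : DifferentiableAt ℝ g z) : dbar (fun w => f w + g w) z = dbar f z + dbar g z := by
  simp only [dbar, fderiv_fun_add hf hg, add_apply]
  ring

lemma dbar_mul {f g : ℂ → ℂ} {z : ℂ} (hf : DifferentiableAt ℝ f z)
    (hg : DifferentiableAt ℝ g z) :
    dbar (fun w => f w * g w) z = dbar f z * g z + f z * dbar g z := by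
  simp only [dbar, fderiv_fun_mul hf hg, add_apply,
    smul_apply, smul_eq_mul]
  ring

lemma dbar_const (c z : ℂ) : dbar (fun _ => c) z = 0 := by
  simp [dbar]

lemma dbar_const_mul (c : ℂ) {f : ℂ → ℂ} {z : ℂ} (hf : DifferentiableAt ℝ f z) :
    dbar (fun w => c * f w) z = c * dbar f z := by
  rw [dbar_mul (differentiableAt_const c) hf, dbar_const]
  ring

lemma dbar_sum {ι : Type*} (s : Finset ι) {f : ι → ℂ → ℂ} {z : ℂ}
    (hf : ∀ i ∈ s, DifferentiableAt ℝ (f i) z) :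
    dbar (fun w => ∑ i ∈ s, f i w) z = ∑ i ∈ s, dbar (f i) z := by
  simp only [dbar, fderiv_fun_sum hf, sum_apply, ← Finset.sum_div,
    Finset.sum_add_distrib, Finset.mul_sum]

/-- `∂̄` annihilates functions that are complex differentiable. -/
lemma dbar_eq_zero_of_differentiableAt {f : ℂ → ℂ} {z : ℂ} (hf : DifferentiableAt ℂ f z) :
    dbar f z = 0 := by
  have h : fderiv ℝ f z = (fderiv ℂ f z).restrictScalars ℝ :=
    (hf.hasFDerivAt.restrictScalars ℝ).fderiv
  have h2 : fderiv ℂ f z Complex.I = Complex.I * fderiv ℂ f z 1 := by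
    rw [← smul_eq_mul, ← map_smul, smul_eq_mul, mul_one]
  simp only [dbar, h, ContinuousLinearMap.coe_restrictScalars', h2, ← mul_assoc, Complex.I_mul_I]
  ring

lemma hasFDerivAt_conj (z : ℂ) :
    HasFDerivAt (fun w : ℂ => conj w) (Complex.conjCLE : ℂ →L[ℝ] ℂ) z :=
  Complex.conjCLE.hasFDerivAt

lemma contDiff_conj {n : WithTop ℕ∞} : ContDiff ℝ n (fun w : ℂ => conj w) :=
  Complex.conjCLE.contDiff

lemma dbar_conj_sub_const (c z : ℂ) : dbar (fun w => conj w - c) z = 1 := by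
  simp only [dbar, ((hasFDerivAt_conj z).sub_const c).fderiv]
  simp

lemma dbar_pow {f : ℂ → ℂ} {z : ℂ} (hf : DifferentiableAt ℝ f z) (n : ℕ) :
    dbar (fun w => f w ^ n) z = n * f z ^ (n - 1) * dbar f z := by
  simp only [dbar, fderiv_fun_pow n hf, smul_apply, nsmul_eq_mul, smul_eq_mul]
  ring

lemma dbar_exp {f : ℂ → ℂ} {z : ℂ} (hf : DifferentiableAt ℝ f z) :
    dbar (fun w => Complex.exp (f w)) z = Complex.exp (f z) * dbar f z := by
  simp only [dbar, hf.hasFDerivAt.cexp.fderiv, smul_apply, smul_eq_mul]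
  ring

lemma dbar_inv {f : ℂ → ℂ} {z : ℂ} (hf : DifferentiableAt ℝ f z) (h0 : f z ≠ 0) :
    dbar (fun w => (f w)⁻¹) z = -dbar f z / f z ^ 2 := by
  have h := dbar_mul (f := fun w => (f w)⁻¹) (hf.fun_inv h0) hf
  have h1 : dbar (fun w => (f w)⁻¹ * f w) z = 0 := by
    rw [← dbar_const 1 z]
    refine dbar_congr ?_
    filter_upwards [hf.continuousAt.eventually_ne h0] with w hw using inv_mul_cancel₀ hw
  rw [h1] at h
  field_simp at h ⊢
  linear_combination -h

lemma contDiffOn_dbar {f : ℂ → ℂ} {U : Set ℂ} (hU : IsOpen U) (hf : ContDiffOn ℝ ∞ f U) :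
    ContDiffOn ℝ ∞ (dbar f) U := by
  have h : ContDiffOn ℝ ∞ (fderiv ℝ f) U := hf.fderiv_of_isOpen hU (by simp)
  unfold dbar
  exact ((h.clm_apply contDiffOn_const).add
    (contDiffOn_const.mul (h.clm_apply contDiffOn_const))).div_const 2

lemma contDiffOn_iterate_dbar {f : ℂ → ℂ} {U : Set ℂ} (hU : IsOpen U)
    (hf : ContDiffOn ℝ ∞ f U) (n : ℕ) : ContDiffOn ℝ ∞ (dbar^[n] f) U := by
  induction n with
  | zero => exact hf
  | succ n ih =>
    rw [Function.iterate_succ_apply']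
    exact contDiffOn_dbar hU ih

lemma contDiff_iterate_dbar {f : ℂ → ℂ} (hf : ContDiff ℝ ∞ f) (n : ℕ) :
    ContDiff ℝ ∞ (dbar^[n] f) :=
  contDiffOn_univ.1 (contDiffOn_iterate_dbar isOpen_univ hf.contDiffOn n)

lemma differentiableAt_of_contDiffOn {f : ℂ → ℂ} {U : Set ℂ} (hU : IsOpen U)
    (hf : ContDiffOn ℝ ∞ f U) {z : ℂ} (hz : z ∈ U) : DifferentiableAt ℝ f z :=
  (hf.differentiableOn (by simp)).differentiableAt (hU.mem_nhds hz)

lemma iterate_dbar_add {f g : ℂ → ℂ} {U : Set ℂ} (hU : IsOpen U) (hf : ContDiffOn ℝ ∞ f U)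
    (hg : ContDiffOn ℝ ∞ g U) (n : ℕ) :
    EqOn (dbar^[n] (fun w => f w + g w)) (fun w => (dbar^[n] f) w + (dbar^[n] g) w) U := by
  induction n with
  | zero => exact fun _ _ => rfl
  | succ n ih =>
    intro z hz
    simp only [Function.iterate_succ_apply']
    rw [dbar_eqOn hU ih hz]
    exact dbar_add (differentiableAt_of_contDiffOn hU (contDiffOn_iterate_dbar hU hf n) hz)
      (differentiableAt_of_contDiffOn hU (contDiffOn_iterate_dbar hU hg n) hz)

/-- Functions that are holomorphic on `U` are constants for `∂̄`. -/
lemma iterate_dbar_holomorphic_mul {h f : ℂ → ℂ} {U : Set ℂ} (hU : IsOpen U)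
    (hh : DifferentiableOn ℂ h U) (hf : ContDiffOn ℝ ∞ f U) (n : ℕ) :
    EqOn (dbar^[n] (fun w => h w * f w)) (fun w => h w * (dbar^[n] f) w) U := by
  induction n with
  | zero => exact fun _ _ => rfl
  | succ n ih =>
    intro z hz
    have hz' := hh.differentiableAt (hU.mem_nhds hz)
    simp only [Function.iterate_succ_apply']
    rw [dbar_eqOn hU ih hz, dbar_mul (hz'.restrictScalars ℝ)
      (differentiableAt_of_contDiffOn hU (contDiffOn_iterate_dbar hU hf n) hz),
      dbar_eq_zero_of_differentiableAt hz']
    ring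

/-- The Leibniz rule. -/
lemma iterate_dbar_mul {f g : ℂ → ℂ} {U : Set ℂ} (hU : IsOpen U) (hf : ContDiffOn ℝ ∞ f U)
    (hg : ContDiffOn ℝ ∞ g U) (n : ℕ) :
    EqOn (dbar^[n] (fun w => f w * g w))
      (fun w => ∑ i ∈ Finset.range (n + 1),
        (n.choose i : ℂ) * ((dbar^[i] f) w * (dbar^[n - i] g) w)) U := by
  induction n with
  | zero => intro z _; simp
  | succ n ih =>
    intro z hz
    have df : ∀ i, DifferentiableAt ℝ (dbar^[i] f) z := fun i =>
      differentiableAt_of_contDiffOn hU (contDiffOn_iterate_dbar hU hf i) hz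
    have dg : ∀ i, DifferentiableAt ℝ (dbar^[i] g) z := fun i =>
      differentiableAt_of_contDiffOn hU (contDiffOn_iterate_dbar hU hg i) hz
    rw [Function.iterate_succ_apply', dbar_eqOn hU ih hz,
      dbar_sum _ fun i _ => ((df i).fun_mul (dg (n - i))).const_mul _]
    dsimp only
    rw [Finset.sum_choose_succ_mul (fun i j => (dbar^[i] f) z * (dbar^[j] g) z) n,
      ← Finset.sum_add_distrib]
    refine Finset.sum_congr rfl fun i hi => ?_
    have hi' : n + 1 - i = n - i + 1 := by have := Finset.mem_range.1 hi; omega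
    rw [dbar_const_mul _ ((df i).fun_mul (dg (n - i))), dbar_mul (df i) (dg (n - i)), hi',
      Function.iterate_succ_apply', Function.iterate_succ_apply']
    ring

/-- For `i > n` the falling factorial is zero, so the truncated exponent is harmless. This vanishing
both kills the top Leibniz term in the Cauchy formula and makes the kernel `q`-analytic. -/
lemma iterate_dbar_conj_sub_pow (c : ℂ) (n i : ℕ) (z : ℂ) :
    (dbar^[i] fun w => (conj w - c) ^ n) z = (n.descFactorial i : ℂ) * (conj z - c) ^ (n - i) := by
  induction i generalizing z with
  | zero => simp
  | succ i ih =>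
    have hd : ∀ w : ℂ, DifferentiableAt ℝ (fun w : ℂ => conj w - c) w := fun w =>
      ((hasFDerivAt_conj w).sub_const c).differentiableAt
    rw [Function.iterate_succ_apply', funext ih, dbar_const_mul _ ((hd z).fun_pow _),
      dbar_pow (hd z), dbar_conj_sub_const, Nat.descFactorial_succ]
    push_cast
    rw [Nat.sub_sub]
    ring

lemma tsupport_dbar_subset (f : ℂ → ℂ) : tsupport (dbar f) ⊆ tsupport f := by
  refine closure_minimal (fun z hz => ?_) (isClosed_tsupport f)
  by_contra h
  refine hz ?_
  have h0 : f =ᶠ[𝓝 z] fun _ => 0 := notMem_tsupport_iff_eventuallyEq.1 h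
  rw [dbar_congr h0, dbar_const]

lemma tsupport_iterate_dbar_subset (f : ℂ → ℂ) (n : ℕ) : tsupport (dbar^[n] f) ⊆ tsupport f := by
  induction n with
  | zero => exact subset_rfl
  | succ n ih =>
    rw [Function.iterate_succ_apply']
    exact (tsupport_dbar_subset _).trans ih

/-! ### A smooth regularization of the fundamental solution of `∂̄^q` -/

/-- The smooth function `(w̄ - z̄)^q / (|w - z|² + e)`, for `e > 0`. -/
def regKernel (q : ℕ) (e : ℝ) (z w : ℂ) : ℂ :=
  (conj w - conj z) ^ q * ((w - z) * (conj w - conj z) + e)⁻¹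

lemma regDenom_eq (e : ℝ) (z w : ℂ) :
    (w - z) * (conj w - conj z) + e = ((‖w - z‖ ^ 2 + e : ℝ) : ℂ) := by
  rw [← map_sub, Complex.mul_conj, Complex.normSq_eq_norm_sq]
  push_cast
  rfl

lemma regDenom_ne_zero {e : ℝ} (he : 0 < e) (z w : ℂ) :
    (w - z) * (conj w - conj z) + e ≠ 0 := by
  rw [regDenom_eq]
  exact_mod_cast (by positivity : ‖w - z‖ ^ 2 + e ≠ 0)

lemma contDiff_regDenom (e : ℝ) (z : ℂ) :
    ContDiff ℝ ∞ (fun w : ℂ => (w - z) * (conj w - conj z) + (e : ℂ)) :=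
  ((contDiff_id.sub contDiff_const).mul (contDiff_conj.sub contDiff_const)).add contDiff_const

lemma contDiff_regKernel (q : ℕ) {e : ℝ} (he : 0 < e) (z : ℂ) :
    ContDiff ℝ ∞ (regKernel q e z) :=
  ((contDiff_conj.sub contDiff_const).pow q).mul
    ((contDiff_regDenom e z).inv (regDenom_ne_zero he z))

lemma dbar_regDenom (e : ℝ) (z w : ℂ) :
    dbar (fun w : ℂ => (w - z) * (conj w - conj z) + (e : ℂ)) w = w - z := by
  have h1 : DifferentiableAt ℂ (fun w : ℂ => w - z) w := by fun_prop
  have h2 : DifferentiableAt ℝ (fun w : ℂ => conj w - conj z) w :=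
    ((hasFDerivAt_conj w).sub_const _).differentiableAt
  rw [dbar_add ((h1.restrictScalars ℝ).fun_mul h2) (differentiableAt_const _), dbar_const,
    dbar_mul (h1.restrictScalars ℝ) h2, dbar_eq_zero_of_differentiableAt h1, dbar_conj_sub_const]
  ring

/-- The Leibniz rule stops after two terms because $\bar\partial(\bar w-c)=1$ and
$\bar\partial^2(\bar w-c)=0$. At `n = 0` the truncated `n - 1` is masked by the coefficient `n`. -/
lemma iterate_dbar_conj_mul {f : ℂ → ℂ} (hf : ContDiff ℝ ∞ f) (c : ℂ) (n : ℕ) (w : ℂ) :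
    (dbar^[n] (fun w => (conj w - c) * f w)) w =
      (conj w - c) * (dbar^[n] f) w + n * (dbar^[n - 1] f) w := by
  have h2 : ∀ w, DifferentiableAt ℝ (fun w : ℂ => conj w - c) w := fun w =>
    ((hasFDerivAt_conj w).sub_const _).differentiableAt
  have hd : ∀ n w, DifferentiableAt ℝ (dbar^[n] f) w := fun n w =>
    ((contDiff_iterate_dbar hf n).differentiable (by simp)).differentiableAt
  induction n generalizing w with
  | zero => simp
  | succ n ih =>
    rw [Function.iterate_succ_apply', funext ih,
      dbar_add ((h2 w).fun_mul (hd n w)) ((hd (n - 1) w).const_mul _), dbar_mul (h2 w) (hd n w),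
      dbar_const_mul _ (hd (n - 1) w), dbar_conj_sub_const, Nat.add_sub_cancel,
      Function.iterate_succ_apply']
    rcases n with _ | n
    · simp; ring
    · rw [Nat.add_sub_cancel, ← Function.iterate_succ_apply' dbar n]
      push_cast
      ring

lemma regKernel_succ (q : ℕ) (e : ℝ) (z : ℂ) :
    regKernel (q + 1) e z = fun w => (conj w - conj z) * regKernel q e z w := by
  ext w
  simp only [regKernel]
  ring

/-- These top derivatives are the approximate identity. In the induction, differentiating the
denominator $D$ releases a factor $w-z$, which pairs with $\bar w-\bar z$ to give $D-e$; the powers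
of $D$ cancel and only $e$ survives. -/
lemma iterate_dbar_regKernel_self (q : ℕ) {e : ℝ} (he : 0 < e) (z w : ℂ) :
    (dbar^[q] (regKernel q e z)) w =
      q ! * (e : ℂ) ^ q / ((w - z) * (conj w - conj z) + e) ^ (q + 1) := by
  induction q generalizing w with
  | zero => simp [regKernel]
  | succ q ih =>
    have hD : ∀ w, DifferentiableAt ℝ (fun w : ℂ => (w - z) * (conj w - conj z) + (e : ℂ)) w :=
      fun w => ((contDiff_regDenom e z).differentiable (by simp)).differentiableAt
    have h0 := regDenom_ne_zero he z w
    rw [regKernel_succ, iterate_dbar_conj_mul (contDiff_regKernel q he z), Nat.add_sub_cancel, ih,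
      Function.iterate_succ_apply', funext ih]
    simp only [div_eq_mul_inv]
    rw [dbar_const_mul _ (((hD w).fun_pow _).fun_inv (pow_ne_zero _ h0)),
      dbar_inv ((hD w).fun_pow _) (pow_ne_zero _ h0), dbar_pow (hD w), dbar_regDenom,
      Nat.factorial_succ, Nat.add_sub_cancel]
    generalize hE : (w - z) * (conj w - conj z) + (e : ℂ) = D at h0
    have hb : (w - z) * (conj w - conj z) = D - e := by rw [← hE]; ring
    field_simp
    push_cast
    linear_combination (-(q ! * (e : ℂ) ^ q * (q + 1) * D ^ (2 * q + 2))) * hb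

/-- Uniformity in `e` is what dominated convergence needs. The factor $\bar w-\bar z$ raises the
order by one, reducing the case $i\le q$ for `q + 1` to orders $i$ and $i-1$ for `q`; the remaining
case $i=q+1$ is read off the explicit formula. -/
lemma norm_iterate_dbar_regKernel_le (q i : ℕ) (hi : i ≤ q) :
    ∃ C : ℝ, 0 ≤ C ∧ ∀ e : ℝ, 0 < e → ∀ z w : ℂ,
      ‖(dbar^[i] (regKernel q e z)) w‖ ≤ C * ‖w - z‖ ^ (q - i) / (‖w - z‖ ^ 2 + e) := by
  have top : ∀ q : ℕ, ∃ C : ℝ, 0 ≤ C ∧ ∀ e : ℝ, 0 < e → ∀ z w : ℂ,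
      ‖(dbar^[q] (regKernel q e z)) w‖ ≤ C * ‖w - z‖ ^ (q - q) / (‖w - z‖ ^ 2 + e) := by
    intro q
    refine ⟨q !, by positivity, fun e he z w => ?_⟩
    rw [iterate_dbar_regKernel_self q he, regDenom_eq, norm_div, norm_mul, norm_pow, norm_pow,
      Complex.norm_natCast, Complex.norm_real, Complex.norm_real, Real.norm_of_nonneg he.le,
      Real.norm_of_nonneg (by positivity), Nat.sub_self, pow_zero, mul_one, pow_succ, ← div_div,
      mul_div_assoc, ← div_pow]
    gcongr
    refine mul_le_of_le_one_right (by positivity) (pow_le_one₀ (by positivity) ?_)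
    rw [div_le_one (by positivity)]
    nlinarith [sq_nonneg ‖w - z‖]
  induction q generalizing i with
  | zero => obtain rfl : i = 0 := by omega
            exact top 0
  | succ q ih =>
    rcases hi.eq_or_lt with rfl | hi
    · exact top _
    obtain ⟨C₁, hC₁, h₁⟩ := ih i (by omega)
    obtain ⟨C₂, hC₂, h₂⟩ := ih (i - 1) (by omega)
    refine ⟨C₁ + i * C₂, by positivity, fun e he z w => ?_⟩
    rw [regKernel_succ, iterate_dbar_conj_mul (contDiff_regKernel q he z)]
    refine (norm_add_le _ _).trans ?_
    rw [norm_mul, norm_mul, Complex.norm_natCast, ← map_sub, Complex.norm_conj, add_mul, add_div]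
    refine add_le_add ?_ ?_
    · refine (mul_le_mul_of_nonneg_left (h₁ e he z w) (norm_nonneg _)).trans_eq ?_
      rw [show q + 1 - i = q - i + 1 by omega, pow_succ]
      ring
    · rcases i with _ | i
      · simp
      · refine (mul_le_mul_of_nonneg_left (h₂ e he z w) (by positivity)).trans_eq ?_
        rw [show q + 1 - (i + 1) = q - (i + 1 - 1) by omega]
        ring

/-- The limit is the `i`-th $\bar\partial$-derivative, off the pole, of the true kernel $(\bar
w-\bar z)^q/(w-z)$. It is zero for `i = q + 1`, where the derivatives concentrate at `z`. -/
lemma tendsto_iterate_dbar_regKernel (q i : ℕ) (hi : i ≤ q + 1) {z w : ℂ} (hw : w ≠ z) :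
    Tendsto (fun e : ℝ => (dbar^[i] (regKernel (q + 1) e z)) w) (𝓝[>] 0)
      (𝓝 (q.descFactorial i * (conj w - conj z) ^ (q - i) / (w - z))) := by
  have hc : w - z ≠ 0 := sub_ne_zero.2 hw
  have hb : conj w - conj z ≠ 0 := by rwa [← map_sub, ne_eq, map_eq_zero]
  have he : Tendsto (fun e : ℝ => (e : ℂ)) (𝓝[>] 0) (𝓝 0) :=
    (Complex.continuous_ofReal.tendsto' 0 0 (by simp)).mono_left nhdsWithin_le_nhds
  have hD : Tendsto (fun e : ℝ => (w - z) * (conj w - conj z) + (e : ℂ)) (𝓝[>] 0)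
      (𝓝 ((w - z) * (conj w - conj z))) := by
    simpa using (tendsto_const_nhds (x := (w - z) * (conj w - conj z))).add he
  have top : ∀ q : ℕ, Tendsto (fun e : ℝ => (dbar^[q + 1] (regKernel (q + 1) e z)) w) (𝓝[>] 0)
      (𝓝 (q.descFactorial (q + 1) * (conj w - conj z) ^ (q - (q + 1)) / (w - z))) := by
    intro q
    have h := ((tendsto_const_nhds (x := ((q + 1)! : ℂ))).mul (he.pow (q + 1))).div
      (hD.pow (q + 1 + 1)) (pow_ne_zero _ (mul_ne_zero hc hb))
    have h0 : q.descFactorial (q + 1) = 0 := Nat.descFactorial_eq_zero_iff_lt.2 (by omega)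
    rw [h0]
    simp only [ne_eq, Nat.add_eq_zero_iff, one_ne_zero, and_false, not_false_eq_true, zero_pow,
      mul_zero, zero_div, Nat.cast_zero, zero_mul] at h ⊢
    refine h.congr' ?_
    filter_upwards [self_mem_nhdsWithin] with e he'
    exact (iterate_dbar_regKernel_self (q + 1) he' z w).symm
  induction q generalizing i with
  | zero =>
    rcases hi.eq_or_lt with rfl | hi
    · exact top 0
    obtain rfl : i = 0 := by omega
    have h := (tendsto_const_nhds (x := conj w - conj z)).mul (hD.inv₀ (mul_ne_zero hc hb))
    have h2 : (conj w - conj z) * ((w - z) * (conj w - conj z))⁻¹ =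
      ((0 : ℕ).descFactorial 0 * (conj w - conj z) ^ (0 - 0) / (w - z)) := by
      simp; field_simp
    rw [h2] at h
    refine h.congr fun e => ?_
    simp [regKernel]
  | succ q ih =>
    rcases hi.eq_or_lt with rfl | hi
    · exact top _
    have h := ((tendsto_const_nhds (x := conj w - conj z)).mul (ih i (by omega))).add
      ((tendsto_const_nhds (x := (i : ℂ))).mul (ih (i - 1) (by omega)))
    have h2 : (conj w - conj z) * (q.descFactorial i * (conj w - conj z) ^ (q - i) / (w - z)) +
        i * (q.descFactorial (i - 1) * (conj w - conj z) ^ (q - (i - 1)) / (w - z)) =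
        (q + 1).descFactorial i * (conj w - conj z) ^ (q + 1 - i) / (w - z) := by
      rcases i with _ | j
      · simp; ring
      · rw [Nat.add_sub_cancel, show q + 1 - (j + 1) = q - j by omega,
          Nat.succ_descFactorial_succ, Nat.descFactorial_succ]
        rcases (show j ≤ q by omega).eq_or_lt with rfl | hj
        · simp; ring
        · rw [show q - j = q - (j + 1) + 1 by omega]
          have : ((q - (j + 1) + 1 : ℕ) : ℂ) = q - j := by
            rw [show q - (j + 1) + 1 = q - j by omega, Nat.cast_sub (by omega)]
          push_cast at this ⊢
          rw [this]
          ring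
    rw [h2] at h
    refine h.congr' ?_
    filter_upwards [self_mem_nhdsWithin] with e he'
    rw [regKernel_succ (q + 1), iterate_dbar_conj_mul (contDiff_regKernel (q + 1) he' z)]

/-! ### The Cauchy formula for `q`-analytic functions -/

lemma integral_area {F : Type*} [NormedAddCommGroup F] [NormedSpace ℝ F] (f : ℂ → F) :
    ∫ w, f w ∂area = Real.pi⁻¹ • ∫ w, f w := by
  rw [area, integral_smul_measure, ENNReal.toReal_ofReal (by positivity)]

lemma area_const_ne_zero : ENNReal.ofReal Real.pi⁻¹ ≠ 0 := by
  simpa using Real.pi_pos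

lemma integrable_area_iff {F : Type*} [NormedAddCommGroup F] {f : ℂ → F} :
    Integrable f area ↔ Integrable f :=
  integrable_smul_measure area_const_ne_zero ENNReal.ofReal_ne_top

instance : IsFiniteMeasureOnCompacts area :=
  ⟨fun K hK => by
    simpa [area] using ENNReal.mul_lt_top ENNReal.ofReal_lt_top hK.measure_lt_top⟩

/-- In polar coordinates the Jacobian $y$ makes the integrand an exact derivative of a multiple of
$(y^2+1)^{-(q+1)}$. -/
lemma integral_bump (q : ℕ) :
    ∫ v : ℂ, Real.pi⁻¹ * ((q + 1) / (‖v‖ ^ 2 + 1) ^ (q + 2)) = 1 := by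
  rw [integral_fun_norm_addHaar volume
    (fun y : ℝ => Real.pi⁻¹ * (((q : ℝ) + 1) / (y ^ 2 + 1) ^ (q + 2)))]
  have hv : volume.real (Metric.ball (0 : ℂ) 1) = Real.pi := by
    simp [Measure.real, Complex.volume_ball]
  rw [hv, Complex.finrank_real_complex]
  have hderiv : ∀ y ∈ Ici (0 : ℝ), HasDerivAt
      (fun y : ℝ => -(2 * Real.pi)⁻¹ * ((y ^ 2 + 1) ^ (q + 1))⁻¹)
      (y ^ (2 - 1) • (Real.pi⁻¹ * (((q : ℝ) + 1) / (y ^ 2 + 1) ^ (q + 2)))) y := by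
    intro y _
    have h1 : HasDerivAt (fun y : ℝ => (y ^ 2 + 1) ^ (q + 1))
        ((q + 1 : ℕ) * (y ^ 2 + 1) ^ q * (2 * y)) y := by
      simpa using ((hasDerivAt_pow 2 y).add_const 1).fun_pow (q + 1)
    have h0 : y ^ 2 + 1 ≠ 0 := by positivity
    refine ((h1.fun_inv (pow_ne_zero _ h0)).const_mul _).congr_deriv ?_
    have := Real.pi_ne_zero
    rw [smul_eq_mul]
    push_cast
    field_simp
    ring
  have hlim : Tendsto (fun y : ℝ => -(2 * Real.pi)⁻¹ * ((y ^ 2 + 1) ^ (q + 1))⁻¹) atTop (𝓝 0) := by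
    have h : Tendsto (fun y : ℝ => (y ^ 2 + 1) ^ (q + 1)) atTop atTop :=
      (tendsto_pow_atTop (by omega)).comp
        (tendsto_atTop_add_const_right _ _ (tendsto_pow_atTop (by omega)))
    simpa using (tendsto_inv_atTop_zero.comp h).const_mul (-(2 * Real.pi)⁻¹)
  rw [integral_Ioi_of_hasDerivAt_of_nonneg' hderiv _ hlim]
  · have := Real.pi_ne_zero
    simp [field]
  · intro y hy
    have : 0 < y := hy
    simp only [smul_eq_mul]
    positivity

/-- With $e=c^{-2}$ the weight is the dilation $c^2\varphi(c(z-w))$ of the normalized bump, so the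
general theorem on approximate identities applies once $|v|^2\varphi(v)\to0$ at infinity. -/
lemma tendsto_integral_bump_mul (q : ℕ) {F : ℂ → ℂ} (hF : Continuous F)
    (hFc : HasCompactSupport F) (z : ℂ) :
    Tendsto (fun c : ℝ => ∫ w, F w * (((q : ℂ) + 1) * ((c⁻¹ ^ 2 : ℝ) : ℂ) ^ (q + 1) /
      ((w - z) * (conj w - conj z) + (c⁻¹ ^ 2 : ℝ)) ^ (q + 2)) ∂area) atTop (𝓝 (F z)) := by
  have hnn : ∀ v : ℂ, 0 ≤ Real.pi⁻¹ * ((q + 1) / (‖v‖ ^ 2 + 1) ^ (q + 2)) :=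
    fun v => by positivity
  have h := tendsto_integral_comp_smul_smul_of_integrable' (μ := (volume : Measure ℂ))
    hnn (integral_bump q) ?_ (x₀ := z)
    (hF.integrable_of_hasCompactSupport hFc) hF.continuousAt
  · refine h.congr' ?_
    filter_upwards [eventually_gt_atTop 0] with c hc
    rw [integral_area, ← integral_smul]
    congr 1
    ext w
    have hc' : (c : ℂ) ≠ 0 := by exact_mod_cast hc.ne'
    have hp : (Real.pi : ℂ) ≠ 0 := by exact_mod_cast Real.pi_ne_zero
    rw [regDenom_eq, Complex.finrank_real_complex, norm_smul, norm_sub_rev z w,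
      Real.norm_of_nonneg hc.le, Complex.real_smul, Complex.real_smul]
    have e1 : (c * ‖w - z‖) ^ 2 + 1 = c ^ 2 * (‖w - z‖ ^ 2 + c⁻¹ ^ 2) := by
      field_simp
    have hD : ((‖w - z‖ ^ 2 + c⁻¹ ^ 2 : ℝ) : ℂ) ≠ 0 := by
      exact_mod_cast (by positivity : ‖w - z‖ ^ 2 + c⁻¹ ^ 2 ≠ 0)
    rw [e1]
    generalize (‖w - z‖ ^ 2 + c⁻¹ ^ 2 : ℝ) = D at hD
    push_cast
    field_simp
    rw [mul_pow, div_pow, one_pow, pow_succ ((c : ℂ) ^ 2) (q + 1)]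
    field_simp
  · rw [Complex.finrank_real_complex]
    have h1 : Tendsto (fun v : ℂ => Real.pi⁻¹ * (q + 1) * (‖v‖ ^ 2 + 1)⁻¹)
        (Bornology.cobounded ℂ) (𝓝 0) := by
      have h : Tendsto (fun v : ℂ => ‖v‖ ^ 2 + 1) (Bornology.cobounded ℂ) atTop :=
        tendsto_atTop_add_const_right _ _
          ((tendsto_pow_atTop two_ne_zero).comp tendsto_norm_cobounded_atTop)
      simpa using (tendsto_inv_atTop_zero.comp h).const_mul (Real.pi⁻¹ * ((q : ℝ) + 1))
    refine squeeze_zero (fun v => by positivity) (fun v => ?_) h1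
    have hx : (0 : ℝ) ≤ ‖v‖ ^ 2 := by positivity
    generalize ‖v‖ ^ 2 = x at hx
    have : x / (x + 1) ^ (q + 2) ≤ (x + 1)⁻¹ := by
      rw [div_le_iff₀ (by positivity), inv_mul_eq_div, le_div_iff₀ (by positivity), pow_succ]
      have h1 : x + 1 ≤ (x + 1) ^ (q + 1) := le_self_pow₀ (by linarith) (by omega)
      nlinarith
    calc x * (Real.pi⁻¹ * ((q + 1) / (x + 1) ^ (q + 2)))
        = Real.pi⁻¹ * (q + 1) * (x / (x + 1) ^ (q + 2)) := by ring
      _ ≤ _ := by gcongr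

/-- In the plane the polar Jacobian cancels $1/|w-z|$, which is therefore integrable on every disk.
-/
lemma integrable_inv_norm_mul {F : ℂ → ℝ} (hF : Continuous F) (hFc : HasCompactSupport F) (z : ℂ) :
    Integrable (fun w => F w * ‖w - z‖⁻¹) := by
  have hloc : ∀ R : ℝ, Integrable (fun w : ℂ => (Iio R).indicator (fun y : ℝ => y⁻¹) ‖w‖) := by
    intro R
    rw [integrable_fun_norm_addHaar volume (f := (Iio R).indicator (fun y : ℝ => y⁻¹)),
      Complex.finrank_real_complex]
    have h1 : IntegrableOn (fun _ : ℝ => (1 : ℝ)) (Ioo 0 R) := by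
      simp
    have h2 : IntegrableOn ((Iio R).indicator fun _ : ℝ => (1 : ℝ)) (Ioi 0) := by
      rw [IntegrableOn, integrable_indicator_iff measurableSet_Iio, IntegrableOn,
        Measure.restrict_restrict measurableSet_Iio, inter_comm, Ioi_inter_Iio]
      exact h1
    refine h2.congr_fun (fun y hy => ?_) measurableSet_Ioi
    have : y ≠ 0 := ne_of_gt hy
    by_cases hyR : y < R <;> simp [indicator, hyR, this]
  obtain ⟨M, hM⟩ := hFc.exists_bound_of_continuous hF
  obtain ⟨R, hR⟩ := hFc.isCompact.isBounded.subset_ball z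
  have h := ((hloc R).comp_sub_right z).const_mul M
  refine h.mono' ?_ (.of_forall fun w => ?_)
  · exact (hF.measurable.mul (by fun_prop)).aestronglyMeasurable
  · rw [norm_mul, norm_inv, norm_norm]
    by_cases hw : w ∈ tsupport F
    · have : ‖w - z‖ < R := by simpa [dist_eq_norm] using hR hw
      simp only [indicator, mem_Iio, this, if_true]
      gcongr
      exact hM w
    · rw [image_eq_zero_of_notMem_tsupport hw]
      have : 0 ≤ M := (norm_nonneg _).trans (hM 0)
      simp only [norm_zero, zero_mul]
      refine mul_nonneg this ?_
      simp only [indicator]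
      split_ifs <;> positivity

/-- For `u` continuous and `∂̄^{q+1} u = 0`, and a test function `g`, one has
`∫ u ∂̄^{q+1} ((w̄ - z̄)^q g) / (w - z) dA = - q! u(z) g(z)`. -/
theorem integral_mul_iterate_dbar_div (q : ℕ) {u : ℂ → ℂ}
    (hu : IsPolyanalyticOn (q + 1) u univ) {g : ℂ → ℂ} (hg : ContDiff ℝ ∞ g)
    (hgc : HasCompactSupport g) (z : ℂ) :
    Integrable (fun w => u w * (dbar^[q + 1] fun w => (conj w - conj z) ^ q * g w) w / (w - z))
      area ∧
    ∫ w, u w * (dbar^[q + 1] fun w => (conj w - conj z) ^ q * g w) w / (w - z) ∂area =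
      -(q ! * u z * g z) := by
  have huc : Continuous u := continuousOn_univ.1 hu.1
  have hpow : ContDiff ℝ ∞ (fun w : ℂ => (conj w - conj z) ^ q) :=
    (contDiff_conj.sub contDiff_const).pow q
  have hgi : ∀ i, Continuous (dbar^[i] g) := fun i => (contDiff_iterate_dbar hg i).continuous
  -- The Leibniz rule for both the kernel and its regularization
  have hlim : ∀ w, w ≠ z → (dbar^[q + 1] fun w => (conj w - conj z) ^ q * g w) w / (w - z) =
      ∑ i ∈ Finset.range (q + 1), ((q + 1).choose i : ℂ) *
        ((q.descFactorial i * (conj w - conj z) ^ (q - i) / (w - z)) * (dbar^[q + 1 - i] g) w) := by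
    intro w hw
    rw [iterate_dbar_mul isOpen_univ hpow.contDiffOn hg.contDiffOn (q + 1) (mem_univ w)]
    dsimp only
    rw [Finset.sum_range_succ]
    -- The term with all `q + 1` derivatives on $(\bar w-\bar z)^q$ drops out; its regularized
    -- counterpart does not vanish and will produce the value at `z`.
    have h0 : q.descFactorial (q + 1) = 0 := Nat.descFactorial_eq_zero_iff_lt.2 (by omega)
    simp only [iterate_dbar_conj_sub_pow, h0, Nat.cast_zero, zero_mul, mul_zero, add_zero]
    rw [Finset.sum_div]
    refine Finset.sum_congr rfl fun i _ => ?_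
    ring
  choose! C hC0 hC using fun i (hi : i ≤ q + 1) => norm_iterate_dbar_regKernel_le (q + 1) i hi
  let S : ℝ → ℂ → ℂ := fun e w => ∑ i ∈ Finset.range (q + 1), ((q + 1).choose i : ℂ) *
        ((dbar^[i] (regKernel (q + 1) e z)) w * (dbar^[q + 1 - i] g) w)
  let bd : ℂ → ℝ := fun w => (‖u w‖ * ∑ i ∈ Finset.range (q + 1), ((q + 1).choose i : ℝ) *
        (C i * ‖w - z‖ ^ (q - i) * ‖(dbar^[q + 1 - i] g) w‖)) * ‖w - z‖⁻¹
  have hbd : Integrable bd area := by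
    rw [integrable_area_iff]
    refine integrable_inv_norm_mul ?_ ?_ z
    · refine huc.norm.mul (continuous_finsetSum _ fun i _ => continuous_const.mul ?_)
      exact (continuous_const.mul (by fun_prop)).mul (hgi _).norm
    · refine HasCompactSupport.mul_left ?_
      refine HasCompactSupport.intro hgc fun w hw => Finset.sum_eq_zero fun i _ => ?_
      rw [image_eq_zero_of_notMem_tsupport (fun h => hw (tsupport_iterate_dbar_subset g _ h))]
      simp
  have hSbd : ∀ e : ℝ, 0 < e → ∀ w, w ≠ z → ‖u w * S e w‖ ≤ bd w := by
    intro e he w hw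
    have hpos : 0 < ‖w - z‖ := norm_pos_iff.2 (sub_ne_zero.2 hw)
    simp only [bd]
    rw [norm_mul, mul_assoc]
    refine mul_le_mul_of_nonneg_left ?_ (norm_nonneg _)
    rw [Finset.sum_mul]
    refine norm_sum_le_of_le _ fun i hi => ?_
    have hi' : i ≤ q := by have := Finset.mem_range.1 hi; omega
    rw [norm_mul, norm_mul, Complex.norm_natCast, mul_assoc]
    refine mul_le_mul_of_nonneg_left ?_ (Nat.cast_nonneg _)
    rw [mul_right_comm]
    refine mul_le_mul_of_nonneg_right ((hC i (by omega) e he z w).trans ?_) (norm_nonneg _)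
    rw [show q + 1 - i = q - i + 1 by omega, pow_succ, div_le_iff₀ (by positivity)]
    have h1 : C i * ‖w - z‖ ^ (q - i) * ‖w - z‖⁻¹ * (‖w - z‖ ^ 2 + e) =
      C i * (‖w - z‖ ^ (q - i) * ‖w - z‖) + C i * ‖w - z‖ ^ (q - i) * ‖w - z‖⁻¹ * e := by
      field_simp
    have := hC0 i (by omega)
    rw [h1]
    have : 0 ≤ C i * ‖w - z‖ ^ (q - i) * ‖w - z‖⁻¹ * e := by positivity
    linarith
  have hne : ∀ᵐ w ∂area, w ≠ z := by
    have h : ∀ᵐ w ∂(volume : Measure ℂ), w ≠ z := by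
      simp [ae_iff]
    exact (Measure.ae_smul_measure_le _) h
  have hSm : ∀ e : ℝ, 0 < e → Continuous (fun w => u w * S e w) := by
    intro e he
    refine huc.mul (continuous_finsetSum _ fun i _ => continuous_const.mul ?_)
    exact (contDiff_iterate_dbar (contDiff_regKernel (q + 1) he z) i).continuous.mul (hgi _)
  have hcinv : Tendsto (fun c : ℝ => c⁻¹ ^ 2) atTop (𝓝[>] 0) := by
    refine tendsto_nhdsWithin_iff.2 ⟨?_, ?_⟩
    · simpa only [ne_eq, OfNat.ofNat_ne_zero, not_false_eq_true, zero_pow] using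
        (tendsto_inv_atTop_zero (𝕜 := ℝ)).pow 2
    filter_upwards [eventually_gt_atTop 0] with c hc
    exact mem_Ioi.2 (by positivity)
  have hpt : ∀ w, w ≠ z → Tendsto (fun c : ℝ => u w * S (c⁻¹ ^ 2) w) atTop
      (𝓝 (u w * (dbar^[q + 1] fun w => (conj w - conj z) ^ q * g w) w / (w - z))) := by
    intro w hw
    rw [mul_div_assoc, hlim w hw]
    refine Tendsto.const_mul _ (tendsto_finsetSum _ fun i hi => Tendsto.const_mul _ ?_)
    have hi' : i ≤ q := by have := Finset.mem_range.1 hi; omega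
    exact ((tendsto_iterate_dbar_regKernel q i (by omega) hw).comp hcinv).mul_const _
  have hmeas : AEStronglyMeasurable
      (fun w => u w * (dbar^[q + 1] fun w => (conj w - conj z) ^ q * g w) w / (w - z)) area := by
    have h1 := (contDiff_iterate_dbar (hpow.mul hg) (q + 1)).continuous
    exact ((huc.mul h1).measurable.div (by fun_prop)).aestronglyMeasurable
  have hA : Tendsto (fun c : ℝ => ∫ w, u w * S (c⁻¹ ^ 2) w ∂area) atTop
      (𝓝 (∫ w, u w * (dbar^[q + 1] fun w => (conj w - conj z) ^ q * g w) w / (w - z) ∂area)) := by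
    refine tendsto_integral_filter_of_dominated_convergence bd ?_ ?_ hbd ?_
    · filter_upwards [eventually_gt_atTop 0] with c hc
      exact (hSm _ (by positivity)).aestronglyMeasurable
    · filter_upwards [eventually_gt_atTop 0] with c hc
      filter_upwards [hne] with w hw using hSbd _ (by positivity) w hw
    · filter_upwards [hne] with w hw using hpt w hw
  have hB := (tendsto_integral_bump_mul q (huc.mul hg.continuous) (hgc.mul_left (f := u)) z).const_mul
    (q ! : ℂ)
  refine ⟨hbd.mono' hmeas ?_, ?_⟩
  -- Integrability of the limit comes from the same majorant, since the pointwise bound is uniform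
  -- in `c`.
  · filter_upwards [hne] with w hw
    refine le_of_tendsto (hpt w hw).norm ?_
    filter_upwards [eventually_gt_atTop 0] with c hc using hSbd _ (by positivity) w hw
  · have hsum := hA.add hB
    have h0 : Tendsto (fun _ : ℝ => (0 : ℂ)) atTop (𝓝 0) := tendsto_const_nhds
    -- The two integrals add up to the pairing of `u` with $\bar\partial^{q+1}(T_eg)$, which is zero
    -- for every `e > 0` by weak `q`-analyticity. Hence their limits cancel.
    have := tendsto_nhds_unique_of_eventuallyEq hsum h0 ?_
    · simp only [Pi.mul_apply] at this
      linear_combination this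
    filter_upwards [eventually_gt_atTop 0] with c hc
    have he : 0 < c⁻¹ ^ 2 := by positivity
    set e := c⁻¹ ^ 2
    have hT := contDiff_regKernel (q + 1) he z
    have hzero := hu.2 (fun w => regKernel (q + 1) e z w * g w) (hT.mul hg) hgc.mul_left
      (subset_univ _)
    rw [← hzero, ← integral_const_mul, ← integral_add]
    · congr 1
      ext w
      rw [iterate_dbar_mul isOpen_univ hT.contDiffOn hg.contDiffOn (q + 1) (mem_univ w)]
      dsimp only
      rw [Finset.sum_range_succ _ (q + 1), iterate_dbar_regKernel_self (q + 1) he]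
      simp only [S, Pi.mul_apply, Nat.choose_self, Nat.sub_self, Function.iterate_zero, id_eq,
        Nat.factorial_succ]
      push_cast
      ring
    · refine (hSm e he).integrable_of_hasCompactSupport (HasCompactSupport.mul_left ?_)
      refine HasCompactSupport.intro hgc fun w hw => Finset.sum_eq_zero fun i _ => ?_
      rw [image_eq_zero_of_notMem_tsupport (fun h => hw (tsupport_iterate_dbar_subset g _ h))]
      simp
    · refine Continuous.integrable_of_hasCompactSupport ?_ ?_
      · refine continuous_const.mul ((huc.mul hg.continuous).mul (continuous_const.div ?_ ?_))
        · exact (contDiff_regDenom e z).continuous.pow _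
        · exact fun w => pow_ne_zero _ (regDenom_ne_zero he z w)
      · exact ((hgc.mul_left (f := u)).mul_right).mul_left

/-! ### Smooth `q`-analytic functions -/

lemma iterate_dbar_sum {ι : Type*} (s : Finset ι) {f : ι → ℂ → ℂ} {U : Set ℂ} (hU : IsOpen U)
    (hf : ∀ i ∈ s, ContDiffOn ℝ ∞ (f i) U) (n : ℕ) :
    EqOn (dbar^[n] (fun w => ∑ i ∈ s, f i w)) (fun w => ∑ i ∈ s, (dbar^[n] (f i)) w) U := by
  induction n with
  | zero => exact fun _ _ => rfl
  | succ n ih =>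
    intro z hz
    simp only [Function.iterate_succ_apply']
    rw [dbar_eqOn hU ih hz]
    exact dbar_sum s fun i hi =>
      differentiableAt_of_contDiffOn hU (contDiffOn_iterate_dbar hU (hf i hi) n) hz

lemma continuous_mul_of_tsupport_subset {f g : ℂ → ℂ} {U : Set ℂ} (hU : IsOpen U)
    (hf : ContinuousOn f U) (hg : Continuous g) (hgU : tsupport g ⊆ U) :
    Continuous (fun w => f w * g w) := by
  refine continuous_of_tsupport fun x hx => ?_
  have hx' : x ∈ U := hgU (closure_mono (Function.support_mul_subset_right f g) hx)
  exact (hf.continuousAt (hU.mem_nhds hx')).mul hg.continuousAt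

lemma integral_mul_dbar {f g : ℂ → ℂ} {U : Set ℂ} (hU : IsOpen U) (hf : ContDiffOn ℝ ∞ f U)
    (hg : ContDiff ℝ ∞ g) (hgc : HasCompactSupport g) (hgU : tsupport g ⊆ U) :
    ∫ w, f w * dbar g w ∂area = -∫ w, dbar f w * g w ∂area := by
  have hf' : ContinuousOn (fderiv ℝ f) U := hf.continuousOn_fderiv_of_isOpen hU (by simp)
  have hg' : Continuous (fderiv ℝ g) := hg.continuous_fderiv (by simp)
  have hsup : ∀ v, tsupport (fun w => fderiv ℝ g w v) ⊆ tsupport g := fun v => by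
    refine closure_minimal (fun z hz => ?_) (isClosed_tsupport g)
    by_contra h
    refine hz ?_
    have h0 : g =ᶠ[𝓝 z] fun _ => 0 := notMem_tsupport_iff_eventuallyEq.1 h
    simp [h0.fderiv_eq]
  have i1 : ∀ v : ℂ, Integrable (fun w => fderiv ℝ f w v * g w) := fun v =>
    (continuous_mul_of_tsupport_subset hU (hf'.clm_apply continuousOn_const) hg.continuous
      hgU).integrable_of_hasCompactSupport hgc.mul_left
  have i2 : ∀ v : ℂ, Integrable (fun w => f w * fderiv ℝ g w v) := fun v =>
    (continuous_mul_of_tsupport_subset hU hf.continuousOn (hg'.clm_apply continuous_const)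
      ((hsup v).trans hgU)).integrable_of_hasCompactSupport
      (HasCompactSupport.mul_left (hgc.mono' (subset_closure.trans (hsup v))))
  have i3 : Integrable (fun w => f w * g w) :=
    (continuous_mul_of_tsupport_subset hU hf.continuousOn hg.continuous
      hgU).integrable_of_hasCompactSupport hgc.mul_left
  have key : ∀ v : ℂ, ∫ w, f w * fderiv ℝ g w v = -∫ w, fderiv ℝ f w v * g w := fun v =>
    integral_mul_fderiv_eq_neg_fderiv_mul_of_integrable (i1 v) (i2 v) i3
      (fun x hx => differentiableAt_of_contDiffOn hU hf (hgU hx))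
      (fun x _ => (hg.differentiable (by simp)).differentiableAt)
  have e1 : ∀ w, f w * dbar g w = 2⁻¹ * (f w * fderiv ℝ g w 1 +
      Complex.I * (f w * fderiv ℝ g w Complex.I)) := fun w => by simp only [dbar]; ring
  have e2 : ∀ w, dbar f w * g w = 2⁻¹ * (fderiv ℝ f w 1 * g w +
      Complex.I * (fderiv ℝ f w Complex.I * g w)) := fun w => by simp only [dbar]; ring
  simp only [integral_area, e1, e2]
  rw [integral_const_mul, integral_const_mul, integral_add (i2 _) ((i2 _).const_mul _),
    integral_add (i1 _) ((i1 _).const_mul _), integral_const_mul, integral_const_mul, key, key,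
    ← smul_neg]
  congr 1
  ring

/-- Each integration by parts moves one $\bar\partial$ from the test function to `f`, with no
boundary term because the test function has compact support inside `U`. -/
lemma isPolyanalyticOn_of_iterate_dbar_eq_zero {f : ℂ → ℂ} {U : Set ℂ} (hU : IsOpen U) (q : ℕ)
    (hf : ContDiffOn ℝ ∞ f U) (h0 : ∀ z ∈ U, (dbar^[q] f) z = 0) : IsPolyanalyticOn q f U := by
  refine ⟨hf.continuousOn, fun g hg hgc hgU => ?_⟩
  have key : ∀ (n : ℕ) (g : ℂ → ℂ), ContDiff ℝ ∞ g → HasCompactSupport g → tsupport g ⊆ U →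
      ∫ w, f w * (dbar^[n] g) w ∂area = (-1) ^ n * ∫ w, (dbar^[n] f) w * g w ∂area := by
    intro n
    induction n with
    | zero => intro g _ _ _; simp
    | succ n ih =>
      intro g hg hgc hgU
      rw [Function.iterate_succ_apply, ih (dbar g) (contDiff_iterate_dbar hg 1)
        (hgc.mono' (subset_closure.trans (tsupport_dbar_subset g)))
        ((tsupport_dbar_subset g).trans hgU),
        integral_mul_dbar hU (contDiffOn_iterate_dbar hU hf n) hg hgc hgU,
        Function.iterate_succ_apply', pow_succ]
      ring
  rw [key q g hg hgc hgU]
  have : ∀ w, (dbar^[q] f) w * g w = 0 := fun w => by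
    by_cases hw : w ∈ tsupport g
    · rw [h0 w (hgU hw), zero_mul]
    · rw [image_eq_zero_of_notMem_tsupport hw, mul_zero]
  simp [this]

/-! ### Averages of analytic functions -/

lemma continuous_compContinuousLinearMap {E E' F : Type*} [NormedAddCommGroup E] [NormedSpace ℂ E]
    [NormedAddCommGroup E'] [NormedSpace ℂ E'] [NormedAddCommGroup F] [NormedSpace ℂ F] {n : ℕ}
    (T : ContinuousMultilinearMap ℂ (fun _ : Fin n => E) F) {M : ℝ → (E' →L[ℂ] E)}
    (hM : Continuous M) : Continuous fun t => T.compContinuousLinearMap fun _ => M t := by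
  have h := (ContinuousMultilinearMap.compContinuousLinearMapContinuousMultilinear ℂ
    (fun _ : Fin n => E') (fun _ : Fin n => E) F).cont
  have h2 : Continuous fun t => (ContinuousMultilinearMap.compContinuousLinearMapContinuousMultilinear
    ℂ (fun _ : Fin n => E') (fun _ : Fin n => E) F) (fun _ => M t) :=
    h.comp (continuous_pi fun _ => hM)
  exact h2.clm_apply continuous_const

/-- If `M_t` is a continuous family of linear maps with `M_t x = y` for all `t`, and `f` is
analytic at `y`, then the average `∫₀¹ f ∘ M_t dt` is analytic at `x`. -/
lemma analyticAt_intervalIntegral_comp {E E' F : Type*} [NormedAddCommGroup E] [NormedSpace ℂ E]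
    [NormedAddCommGroup E'] [NormedSpace ℂ E'] [NormedAddCommGroup F] [NormedSpace ℂ F]
    [CompleteSpace F] {f : E → F} {M : ℝ → (E' →L[ℂ] E)} (hM : Continuous M) {x : E'} {y : E}
    (hxy : ∀ t, M t x = y) (hf : AnalyticAt ℂ f y) :
    AnalyticAt ℂ (fun v => ∫ t in (0 : ℝ)..1, f (M t v)) x := by
  obtain ⟨p, R, hp⟩ := hf
  obtain ⟨K, hK⟩ := (isCompact_Icc (a := (0 : ℝ)) (b := 1)).exists_bound_of_continuousOn
    hM.continuousOn
  have hKpos : 0 < K + 1 := by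
    have := (norm_nonneg _).trans (hK 0 (by simp))
    linarith
  have hMK : ∀ t ∈ Set.uIoc (0 : ℝ) 1, ‖M t‖ ≤ K + 1 := fun t ht => by
    rw [uIoc_of_le zero_le_one] at ht
    have := hK t ⟨ht.1.le, ht.2⟩
    linarith
  obtain ⟨s, hs0, hsR⟩ := ENNReal.lt_iff_exists_nnreal_btwn.1 hp.r_pos
  have hs0' : (0 : ℝ) < s := by exact_mod_cast hs0
  -- Dividing by `K + 1`, a common bound for the norms of `M t`, keeps every `M t v` with `‖v‖ < ρ`
  -- in the disk of radius `s`.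
  let ρ : NNReal := ⟨s / (K + 1), by positivity⟩
  have hρ : (ρ : ℝ) = s / (K + 1) := rfl
  have hρ0 : (0 : ℝ) < ρ := by rw [hρ]; positivity
  let G : FormalMultilinearSeries ℂ E' F := fun n =>
    ∫ t in (0 : ℝ)..1, (p n).compContinuousLinearMap fun _ => M t
  have hcomp : ∀ n, Continuous fun t => (p n).compContinuousLinearMap fun _ => M t := fun n =>
    continuous_compContinuousLinearMap (p n) hM
  have hG : ∀ n, ‖G n‖ ≤ ‖p n‖ * (K + 1) ^ n := by
    intro n
    have := intervalIntegral.norm_integral_le_of_norm_le_const (a := (0 : ℝ)) (b := 1)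
      (f := fun t => (p n).compContinuousLinearMap fun _ => M t) (C := ‖p n‖ * (K + 1) ^ n) ?_
    · simpa using this
    · intro t ht
      refine (ContinuousMultilinearMap.norm_compContinuousLinearMap_le _ _).trans ?_
      rw [Finset.prod_const, Finset.card_univ, Fintype.card_fin]
      gcongr
      exact hMK t ht
  have hsum : Summable fun n => ‖p n‖ * (s : ℝ) ^ n :=
    p.summable_norm_mul_pow (hsR.trans_le hp.r_le)
  refine ⟨G, ρ, ?_, by exact_mod_cast hρ0, ?_⟩
  · refine G.le_radius_of_summable (hsum.of_nonneg_of_le (fun n => by positivity) fun n => ?_)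
    refine (mul_le_mul_of_nonneg_right (hG n) (by positivity)).trans_eq ?_
    rw [hρ, mul_assoc, ← mul_pow]
    field_simp
  · intro v hv
    have hv' : ‖v‖ < ρ := by simpa using hv
    have hvM : ∀ t ∈ Set.uIoc (0 : ℝ) 1, ‖M t v‖ < s := fun t ht => by
      calc ‖M t v‖ ≤ ‖M t‖ * ‖v‖ := (M t).le_opNorm v
        _ ≤ (K + 1) * ‖v‖ := by gcongr; exact hMK t ht
        _ < (K + 1) * ρ := by gcongr
        _ = s := by rw [hρ]; field_simp
    have hGv : ∀ n, G n (fun _ => v) = ∫ t in (0 : ℝ)..1, p n fun _ => M t v := by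
      intro n
      have := (ContinuousMultilinearMap.apply ℂ (fun _ : Fin n => E') F
        (fun _ => v)).intervalIntegral_comp_comm (μ := volume)
        ((hcomp n).intervalIntegrable 0 1)
      simpa [G] using this.symm
    simp only [hGv]
    refine intervalIntegral.hasSum_integral_of_dominated_convergence
      (fun n _ => ‖p n‖ * (s : ℝ) ^ n) ?_ ?_ ?_ ?_ ?_
    · intro n
      have : Continuous fun t => p n fun _ => M t v :=
        (p n).cont.comp (continuous_pi fun _ => hM.clm_apply continuous_const)
      exact this.aestronglyMeasurable
    · refine fun n => .of_forall fun t ht => ?_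
      refine (p n).le_opNorm _ |>.trans ?_
      rw [Finset.prod_const, Finset.card_univ, Fintype.card_fin]
      gcongr
      exact (hvM t ht).le
    · exact .of_forall fun t _ => hsum
    · exact intervalIntegrable_const
    · refine .of_forall fun t ht => ?_
      -- All the maps send `x` to the same `y`, so one power series serves every `t` and can be
      -- averaged termwise.
      rw [map_add, hxy]
      refine hp.hasSum ?_
      have h : M t v ∈ Metric.eball (0 : E) s := by simpa using hvM t ht
      exact Metric.eball_subset_eball hsR.le h

/-! ### Wirtinger derivatives of `Ψ(w, w̄)` for holomorphic `Ψ` -/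

lemma hasFDerivAt_comp_conj {Ψ : ℂ × ℂ → ℂ} {w : ℂ} {L : ℂ × ℂ →L[ℂ] ℂ}
    (h : HasFDerivAt Ψ L (w, conj w)) :
    HasFDerivAt (fun w => Ψ (w, conj w)) ((L.restrictScalars ℝ).comp
      ((ContinuousLinearMap.id ℝ ℂ).prod (Complex.conjCLE : ℂ →L[ℝ] ℂ))) w :=
  HasFDerivAt.comp w (h.restrictScalars ℝ) ((hasFDerivAt_id w).prodMk (hasFDerivAt_conj w))

lemma clm_prod_apply (L : ℂ × ℂ →L[ℂ] ℂ) (a b : ℂ) : L (a, b) = a * L (1, 0) + b * L (0, 1) := by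
  have : ((a, b) : ℂ × ℂ) = a • (1, 0) + b • (0, 1) := by simp
  rw [this, map_add, map_smul, map_smul, smul_eq_mul, smul_eq_mul]

lemma dbar_comp_conj {Ψ : ℂ × ℂ → ℂ} {w : ℂ} (h : DifferentiableAt ℂ Ψ (w, conj w)) :
    dbar (fun w => Ψ (w, conj w)) w = fderiv ℂ Ψ (w, conj w) (0, 1) := by
  simp only [dbar, (hasFDerivAt_comp_conj h.hasFDerivAt).fderiv]
  simp only [ContinuousLinearMap.comp_apply, ContinuousLinearMap.prod_apply,
    ContinuousLinearMap.id_apply, ContinuousLinearMap.coe_restrictScalars',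
    ContinuousLinearEquiv.coe_coe, Complex.conjCLE_apply, map_one, Complex.conj_I]
  rw [clm_prod_apply _ 1 1, clm_prod_apply _ Complex.I (-Complex.I)]
  linear_combination (fderiv ℂ Ψ (w, conj w) (1, 0) - fderiv ℂ Ψ (w, conj w) (0, 1)) / 2 *
    Complex.I_mul_I

lemma dz_comp_conj {Ψ : ℂ × ℂ → ℂ} {w : ℂ} (h : DifferentiableAt ℂ Ψ (w, conj w)) :
    dz (fun w => Ψ (w, conj w)) w = fderiv ℂ Ψ (w, conj w) (1, 0) := by
  simp only [dz, (hasFDerivAt_comp_conj h.hasFDerivAt).fderiv]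
  simp only [ContinuousLinearMap.comp_apply, ContinuousLinearMap.prod_apply,
    ContinuousLinearMap.id_apply, ContinuousLinearMap.coe_restrictScalars',
    ContinuousLinearEquiv.coe_coe, Complex.conjCLE_apply, map_one, Complex.conj_I]
  rw [clm_prod_apply _ 1 1, clm_prod_apply _ Complex.I (-Complex.I)]
  linear_combination (-fderiv ℂ Ψ (w, conj w) (1, 0) + fderiv ℂ Ψ (w, conj w) (0, 1)) / 2 *
    Complex.I_mul_I

lemma dz_congr {f g : ℂ → ℂ} {z : ℂ} (h : f =ᶠ[𝓝 z] g) : dz f z = dz g z := by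
  simp only [dz, h.fderiv_eq]

lemma conj_mem_ball {z₀ : ℂ} {r : ℝ} {w : ℂ} (hw : w ∈ Metric.ball z₀ r) :
    conj w ∈ Metric.ball (conj z₀) r := by
  rw [Metric.mem_ball, Complex.dist_conj_conj]
  exact hw

/-! ### Functions `F(z, w) = Φ(z, w, w̄)` with `Φ` holomorphic -/

/-- The product `𝔻(z₀, r) × 𝔻(z₀, r) × 𝔻(z̄₀, r)`. -/
def triball (z₀ : ℂ) (r : ℝ) : Set (ℂ × ℂ × ℂ) :=
  Metric.ball z₀ r ×ˢ Metric.ball z₀ r ×ˢ Metric.ball (conj z₀) r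

/-- `F` is, on `𝔻(z₀, r)²`, a holomorphic function of `(z, w, w̄)`. -/
def IsTriholomorphic (z₀ : ℂ) (r : ℝ) (F : ℂ → ℂ → ℂ) : Prop :=
  ∃ Φ : ℂ × ℂ × ℂ → ℂ, AnalyticOnNhd ℂ Φ (triball z₀ r) ∧
    ∀ z ∈ Metric.ball z₀ r, ∀ w ∈ Metric.ball z₀ r, F z w = Φ (z, w, conj w)

section Triholomorphic

variable {z₀ : ℂ} {r : ℝ}

lemma mem_triball {z w : ℂ} (hz : z ∈ Metric.ball z₀ r) (hw : w ∈ Metric.ball z₀ r) :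
    (z, w, conj w) ∈ triball z₀ r := ⟨hz, hw, conj_mem_ball hw⟩

lemma analyticAt_snd_fst (x : ℂ × ℂ × ℂ) : AnalyticAt ℂ (fun x : ℂ × ℂ × ℂ => x.2.1) x :=
  AnalyticAt.comp (g := Prod.fst) (f := Prod.snd) analyticAt_fst analyticAt_snd

lemma analyticAt_snd_snd (x : ℂ × ℂ × ℂ) : AnalyticAt ℂ (fun x : ℂ × ℂ × ℂ => x.2.2) x :=
  AnalyticAt.comp (g := Prod.snd) (f := Prod.snd) analyticAt_snd analyticAt_snd

namespace IsTriholomorphic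

lemma mul {F G : ℂ → ℂ → ℂ} (hF : IsTriholomorphic z₀ r F) (hG : IsTriholomorphic z₀ r G) :
    IsTriholomorphic z₀ r fun z w => F z w * G z w := by
  obtain ⟨Φ, h, e⟩ := hF
  obtain ⟨Ψ, h', e'⟩ := hG
  exact ⟨fun x => Φ x * Ψ x, h.mul h', fun z hz w hw => by
    simp only [e z hz w hw, e' z hz w hw]⟩

lemma neg {F : ℂ → ℂ → ℂ} (hF : IsTriholomorphic z₀ r F) :
    IsTriholomorphic z₀ r fun z w => -F z w := by
  obtain ⟨Φ, h, e⟩ := hF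
  exact ⟨fun x => -Φ x, h.neg, fun z hz w hw => by simp only [e z hz w hw]⟩

lemma const (c : ℂ) : IsTriholomorphic z₀ r fun _ _ => c :=
  ⟨fun _ => c, analyticOnNhd_const, fun _ _ _ _ => rfl⟩

lemma exp {F : ℂ → ℂ → ℂ} (hF : IsTriholomorphic z₀ r F) :
    IsTriholomorphic z₀ r fun z w => Complex.exp (F z w) := by
  obtain ⟨Φ, h, e⟩ := hF
  exact ⟨fun x => Complex.exp (Φ x), h.cexp, fun z hz w hw => by simp only [e z hz w hw]⟩

lemma fst_sub_snd : IsTriholomorphic z₀ r fun z w => z - w :=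
  ⟨fun x => x.1 - x.2.1, fun x _ => analyticAt_fst.sub (analyticAt_snd_fst x), fun _ _ _ _ => rfl⟩

lemma analyticOnNhd {F : ℂ → ℂ → ℂ} (hF : IsTriholomorphic z₀ r F) :
    AnalyticOnNhd ℝ (fun x : ℂ × ℂ => F x.1 x.2) (Metric.ball z₀ r ×ˢ Metric.ball z₀ r) := by
  obtain ⟨Φ, h, e⟩ := hF
  have hm : AnalyticOnNhd ℝ (fun x : ℂ × ℂ => (x.1, x.2, conj x.2)) univ := fun x _ =>
    analyticAt_fst.prod (analyticAt_snd.prod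
      ((Complex.conjCLE : ℂ →L[ℝ] ℂ).analyticAt _ |>.comp analyticAt_snd))
  have h2 : AnalyticOnNhd ℝ (fun x : ℂ × ℂ => Φ (x.1, x.2, conj x.2))
      (Metric.ball z₀ r ×ˢ Metric.ball z₀ r) := fun x hx =>
    AnalyticAt.comp (f := fun x : ℂ × ℂ => (x.1, x.2, conj x.2))
      ((h _ (mem_triball hx.1 hx.2)).restrictScalars (𝕜 := ℝ)) (hm x (mem_univ _))
  exact h2.congr (Metric.isOpen_ball.prod Metric.isOpen_ball)
    fun x hx => (e x.1 hx.1 x.2 hx.2).symm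

lemma analyticOnNhd_right {F : ℂ → ℂ → ℂ} (hF : IsTriholomorphic z₀ r F) {z : ℂ}
    (hz : z ∈ Metric.ball z₀ r) : AnalyticOnNhd ℝ (F z) (Metric.ball z₀ r) := fun w hw =>
  AnalyticAt.comp (g := fun x : ℂ × ℂ => F x.1 x.2) (f := fun w => (z, w))
    (hF.analyticOnNhd (z, w) ⟨hz, hw⟩) (analyticAt_const.prod analyticAt_id)

lemma contDiffOn_right {F : ℂ → ℂ → ℂ} (hF : IsTriholomorphic z₀ r F) {z : ℂ}
    (hz : z ∈ Metric.ball z₀ r) : ContDiffOn ℝ ∞ (F z) (Metric.ball z₀ r) :=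
  (hF.analyticOnNhd_right hz).contDiffOn Metric.isOpen_ball.uniqueDiffOn

lemma differentiableOn_left {F : ℂ → ℂ → ℂ} (hF : IsTriholomorphic z₀ r F) {w : ℂ}
    (hw : w ∈ Metric.ball z₀ r) : DifferentiableOn ℂ (fun z => F z w) (Metric.ball z₀ r) := by
  obtain ⟨Φ, h, e⟩ := hF
  have h2 : DifferentiableOn ℂ (fun z => Φ (z, w, conj w)) (Metric.ball z₀ r) := fun z hz =>
    (DifferentiableAt.comp (g := Φ) (f := fun z => (z, w, conj w)) z
      (h _ (mem_triball hz hw)).differentiableAt (by fun_prop)).differentiableWithinAt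
  exact h2.congr fun z hz => e z hz w hw

lemma dbar_right {F : ℂ → ℂ → ℂ} (hF : IsTriholomorphic z₀ r F) :
    IsTriholomorphic z₀ r fun z w => dbar (F z) w := by
  obtain ⟨Φ, h, e⟩ := hF
  refine ⟨fun x => fderiv ℂ Φ x (0, 0, 1), fun x hx => ?_, fun z hz w hw => ?_⟩
  · exact ((ContinuousLinearMap.apply ℂ ℂ ((0, 0, 1) : ℂ × ℂ × ℂ)).analyticAt _).comp
      (h.fderiv x hx)
  · have hd := (h _ (mem_triball hz hw)).differentiableAt
    have hpair : HasFDerivAt (fun y : ℂ × ℂ => (z, y))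
        ((0 : ℂ × ℂ →L[ℂ] ℂ).prod (ContinuousLinearMap.id ℂ (ℂ × ℂ))) (w, conj w) :=
      (hasFDerivAt_const z _).prodMk (hasFDerivAt_id _)
    have hc : HasFDerivAt (fun y : ℂ × ℂ => Φ (z, y))
        ((fderiv ℂ Φ (z, w, conj w)).comp
          ((0 : ℂ × ℂ →L[ℂ] ℂ).prod (ContinuousLinearMap.id ℂ (ℂ × ℂ)))) (w, conj w) :=
      HasFDerivAt.comp (g := Φ) _ hd.hasFDerivAt hpair
    beta_reduce
    rw [dbar_eqOn Metric.isOpen_ball (e z hz) hw,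
      dbar_comp_conj (Ψ := fun y => Φ (z, y)) hc.differentiableAt, hc.fderiv]
    simp

lemma iterate_dbar_right {F : ℂ → ℂ → ℂ} (hF : IsTriholomorphic z₀ r F) (n : ℕ) :
    IsTriholomorphic z₀ r fun z w => (dbar^[n] (F z)) w := by
  induction n with
  | zero => exact hF
  | succ n ih =>
    simp only [Function.iterate_succ_apply']
    exact ih.dbar_right

end IsTriholomorphic

/-! ### The phase function -/

/-- The difference quotient of `p` in its first variable. -/
def diffQuot (p : ℂ × ℂ → ℂ) (x : ℂ × ℂ × ℂ) : ℂ :=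
  if x.2.1 = x.1 then fderiv ℂ p (x.1, x.2.2) (1, 0)
  else (p (x.2.1, x.2.2) - p (x.1, x.2.2)) / (x.2.1 - x.1)

lemma hasDerivAt_segment {p : ℂ × ℂ → ℂ} {a c b : ℂ} {t : ℝ}
    (h : DifferentiableAt ℂ p (a + t * (c - a), b)) :
    HasDerivAt (fun t : ℝ => p (a + t * (c - a), b))
      ((c - a) * fderiv ℂ p (a + t * (c - a), b) (1, 0)) t := by
  have h1 : HasDerivAt (fun t : ℝ => a + (t : ℂ) * (c - a)) (c - a) t := by
    simpa using ((Complex.ofRealCLM.hasDerivAt (x := t)).mul_const (c - a)).const_add a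
  have h2 := (h.hasFDerivAt.restrictScalars ℝ).comp_hasDerivAt t (h1.prodMk (hasDerivAt_const t b))
  refine h2.congr_deriv ?_
  rw [ContinuousLinearMap.coe_restrictScalars', clm_prod_apply]
  simp

lemma add_mul_sub_mem_ball {a c : ℂ} (ha : a ∈ Metric.ball z₀ r) (hc : c ∈ Metric.ball z₀ r)
    {t : ℝ} (ht : t ∈ Icc (0 : ℝ) 1) : a + t * (c - a) ∈ Metric.ball z₀ r := by
  have := (convex_ball z₀ r).add_smul_sub_mem ha hc ht
  simpa [Complex.real_smul] using this

lemma diffQuot_eq_integral {p : ℂ × ℂ → ℂ}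
    (hp : AnalyticOnNhd ℂ p (Metric.ball z₀ r ×ˢ Metric.ball (conj z₀) r)) {x : ℂ × ℂ × ℂ}
    (hx : x ∈ triball z₀ r) :
    diffQuot p x = ∫ t in (0 : ℝ)..1, fderiv ℂ p (x.1 + t * (x.2.1 - x.1), x.2.2) (1, 0) := by
  obtain ⟨a, c, b⟩ := x
  obtain ⟨ha, hc, hb⟩ := hx
  dsimp only at ha hc hb
  by_cases hca : c = a
  · simp [diffQuot, hca]
  · simp only [diffQuot, hca, if_false]
    rw [div_eq_iff (sub_ne_zero.2 hca), mul_comm, ← intervalIntegral.integral_const_mul]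
    have hmem : ∀ t ∈ uIcc (0 : ℝ) 1, (a + t * (c - a), b) ∈
        Metric.ball z₀ r ×ˢ Metric.ball (conj z₀) r := fun t ht => by
      rw [uIcc_of_le zero_le_one] at ht
      exact ⟨add_mul_sub_mem_ball ha hc ht, hb⟩
    have hcont : ContinuousOn (fun t : ℝ => fderiv ℂ p (a + t * (c - a), b)) (uIcc 0 1) :=
      hp.fderiv.continuousOn.comp (f := fun t : ℝ => (a + (t : ℂ) * (c - a), b))
        (by fun_prop) hmem
    rw [intervalIntegral.integral_eq_sub_of_hasDerivAt
      (f := fun t : ℝ => p (a + t * (c - a), b))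
      (fun t ht => hasDerivAt_segment (hp _ (hmem t ht)).differentiableAt)]
    · simp
    · exact (continuousOn_const.mul (hcont.clm_apply continuousOn_const)).intervalIntegrable

/-- Away from `x.2.1 = x.1` this is a quotient with nonzero denominator. At such a point the
quotient is rewritten as the average of $\partial_ap$ over the segment joining the two arguments, so
joint analyticity passes through the removable singularity. -/
lemma analyticOnNhd_diffQuot {p : ℂ × ℂ → ℂ}
    (hp : AnalyticOnNhd ℂ p (Metric.ball z₀ r ×ˢ Metric.ball (conj z₀) r)) :
    AnalyticOnNhd ℂ (diffQuot p) (triball z₀ r) := by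
  have hopen : IsOpen (triball z₀ r) :=
    Metric.isOpen_ball.prod (Metric.isOpen_ball.prod Metric.isOpen_ball)
  rintro ⟨a, c, b⟩ hx
  obtain ⟨ha, hc, hb⟩ := hx
  dsimp only at ha hc hb
  by_cases hca : c = a
  · subst hca
    let f1 : ℂ × ℂ × ℂ →L[ℂ] ℂ := ContinuousLinearMap.fst ℂ ℂ (ℂ × ℂ)
    let f2 : ℂ × ℂ × ℂ →L[ℂ] ℂ :=
      (ContinuousLinearMap.fst ℂ ℂ ℂ).comp (ContinuousLinearMap.snd ℂ ℂ (ℂ × ℂ))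
    let f3 : ℂ × ℂ × ℂ →L[ℂ] ℂ :=
      (ContinuousLinearMap.snd ℂ ℂ ℂ).comp (ContinuousLinearMap.snd ℂ ℂ (ℂ × ℂ))
    -- The map $(a,c,b)\mapsto(a+t(c-a),b)$ is linear for each `t`, and sends $(c,c,b)$ to $(c,b)$
    -- whatever `t` is, as the averaging lemma requires.
    let M : ℝ → (ℂ × ℂ × ℂ →L[ℂ] ℂ × ℂ) := fun t =>
      f1.prod f3 + (t : ℂ) • (f2 - f1).prod 0
    have hM : Continuous M := by fun_prop
    have hMx : ∀ t x, M t x = (x.1 + t * (x.2.1 - x.1), x.2.2) := fun t x => by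
      simp [M, f1, f2, f3]
    have hD : AnalyticAt ℂ (fun y => fderiv ℂ p y (1, 0)) (c, b) :=
      ((ContinuousLinearMap.apply ℂ ℂ ((1, 0) : ℂ × ℂ)).analyticAt _).comp
        (hp.fderiv (c, b) ⟨ha, hb⟩)
    have h := analyticAt_intervalIntegral_comp hM (x := (c, c, b)) (y := (c, b))
      (fun t => by simp [hMx]) hD
    refine h.congr ?_
    filter_upwards [hopen.mem_nhds (⟨ha, hc, hb⟩ : (c, c, b) ∈ triball z₀ r)] with x hx
    rw [diffQuot_eq_integral hp hx]
    simp only [hMx]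
  · have h1 : AnalyticAt ℂ (fun x : ℂ × ℂ × ℂ =>
        (p (x.2.1, x.2.2) - p (x.1, x.2.2)) / (x.2.1 - x.1)) (a, c, b) := by
      refine AnalyticAt.div (AnalyticAt.sub ?_ ?_) ((analyticAt_snd_fst _).sub analyticAt_fst)
        (sub_ne_zero.2 hca)
      · exact AnalyticAt.comp (g := p) (f := fun x : ℂ × ℂ × ℂ => (x.2.1, x.2.2))
          (hp (c, b) ⟨hc, hb⟩) ((analyticAt_snd_fst _).prod (analyticAt_snd_snd _))
      · exact AnalyticAt.comp (g := p) (f := fun x : ℂ × ℂ × ℂ => (x.1, x.2.2))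
          (hp (a, b) ⟨ha, hb⟩) (analyticAt_fst.prod (analyticAt_snd_snd _))
    refine h1.congr ?_
    have hne : ∀ᶠ x : ℂ × ℂ × ℂ in 𝓝 (a, c, b), x.2.1 ≠ x.1 :=
      (isOpen_ne_fun (by fun_prop) (by fun_prop)).mem_nhds hca
    filter_upwards [hne] with x hx
    simp [diffQuot, hx]

section Polarization

variable {Q : ℂ → ℝ} {P : ℂ → ℂ → ℂ}

lemma IsPolarization.dz_eq (hP : IsPolarization Q z₀ r P) {z : ℂ} (hz : z ∈ Metric.ball z₀ r) :
    dz (fun ζ => (Q ζ : ℂ)) z =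
      fderiv ℂ (fun p : ℂ × ℂ => P p.1 (conj p.2)) (z, conj z) (1, 0) := by
  rw [← dz_comp_conj (hP.analytic (z, conj z) ⟨hz, conj_mem_ball hz⟩).differentiableAt]
  refine dz_congr ?_
  filter_upwards [Metric.isOpen_ball.mem_nhds hz] with w hw
  simp [hP.diag w hw]

/-- Since $Q(w)=p(w,\bar w)$ and $Q(z,w)=p(z,\bar w)$, the numerator is an increment of
$p(\cdot,\bar w)$ from $z$ to $w$, with the second slot frozen. -/
lemma IsPolarization.isTriholomorphic_phase (hP : IsPolarization Q z₀ r P) :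
    IsTriholomorphic z₀ r (phase Q P) := by
  refine ⟨diffQuot fun p => P p.1 (conj p.2), analyticOnNhd_diffQuot hP.analytic,
    fun z hz w hw => ?_⟩
  by_cases hwz : w = z
  · subst hwz
    simp [phase, diffQuot, hP.dz_eq hz]
  · simp [phase, diffQuot, hwz, hP.diag w hw]

lemma IsPolarization.isTriholomorphic_expPhase (hP : IsPolarization Q z₀ r P) (m : ℝ) :
    IsTriholomorphic z₀ r (expPhase m Q P) :=
  (((IsTriholomorphic.const _).mul .fst_sub_snd).mul hP.isTriholomorphic_phase).exp

/-- The coefficient of `(z̄ - w̄)^k` in `kernelR`. -/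
def kernelCoeff (k : ℕ) (m : ℝ) (Q : ℂ → ℝ) (P : ℂ → ℂ → ℂ) (z w : ℂ) : ℂ :=
  (dbar^[k] (fun η => dbar (fun ξ => phase Q P z ξ) η * expPhase m Q P z η)) w *
    Complex.exp (-((m : ℂ) * (z - w) * phase Q P z w))

lemma IsPolarization.isTriholomorphic_kernelCoeff (hP : IsPolarization Q z₀ r P) (k : ℕ) (m : ℝ) :
    IsTriholomorphic z₀ r (kernelCoeff k m Q P) :=
  ((hP.isTriholomorphic_phase.dbar_right.mul (hP.isTriholomorphic_expPhase m)).iterate_dbar_right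
    k).mul (((IsTriholomorphic.const _).mul .fst_sub_snd).mul hP.isTriholomorphic_phase).neg.exp

lemma kernelR_eq (q : ℕ) (m : ℝ) (z w : ℂ) : kernelR q m Q P z w =
    ∑ k ∈ Finset.range q, (kernelCoeff k m Q P z w * ((m : ℂ) *
      ((q ! : ℂ) * (-1) ^ k / (((q - 1 - k)! : ℂ) * ((k + 1)! : ℂ) * (k ! : ℂ))))) *
      (conj z - conj w) ^ k := by
  rw [kernelR, Finset.mul_sum]
  refine Finset.sum_congr rfl fun k _ => ?_
  rw [kernelCoeff]
  ring

lemma IsPolarization.analyticOnNhd_kernelR (hP : IsPolarization Q z₀ r P) (q : ℕ) (m : ℝ) {z : ℂ}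
    (hz : z ∈ Metric.ball z₀ r) :
    AnalyticOnNhd ℝ (fun w => kernelR q m Q P z w) (Metric.ball z₀ r) := by
  simp only [kernelR_eq]
  refine Finset.analyticOnNhd_fun_sum _ fun k _ => ?_
  refine (((hP.isTriholomorphic_kernelCoeff k m).analyticOnNhd_right hz).mul
    analyticOnNhd_const).mul (AnalyticOnNhd.pow (analyticOnNhd_const.sub ?_) k)
  exact fun w _ => (Complex.conjCLE : ℂ →L[ℝ] ℂ).analyticAt w

/-- All non-holomorphic dependence on `z` sits in the powers $(\bar z-\bar w)^k$ with $k<q$, each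
annihilated by $\bar\partial^q$. -/
lemma IsPolarization.isPolyanalyticOn_kernelR (hP : IsPolarization Q z₀ r P) (q : ℕ) (m : ℝ) {w : ℂ}
    (hw : w ∈ Metric.ball z₀ r) :
    IsPolyanalyticOn q (fun z => kernelR q m Q P z w) (Metric.ball z₀ r) := by
  have hhol : ∀ k, DifferentiableOn ℂ (fun z => kernelCoeff k m Q P z w * ((m : ℂ) *
      ((q ! : ℂ) * (-1) ^ k / (((q - 1 - k)! : ℂ) * ((k + 1)! : ℂ) * (k ! : ℂ)))))
      (Metric.ball z₀ r) := fun k =>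
    ((hP.isTriholomorphic_kernelCoeff k m).differentiableOn_left hw).mul_const _
  have hpow : ∀ k, ContDiffOn ℝ ∞ (fun z : ℂ => (conj z - conj w) ^ k) (Metric.ball z₀ r) :=
    fun k => ((contDiff_conj.sub contDiff_const).pow k).contDiffOn
  have hterm : ∀ k, ContDiffOn ℝ ∞ (fun z => (kernelCoeff k m Q P z w * ((m : ℂ) *
      ((q ! : ℂ) * (-1) ^ k / (((q - 1 - k)! : ℂ) * ((k + 1)! : ℂ) * (k ! : ℂ))))) *
      (conj z - conj w) ^ k) (Metric.ball z₀ r) := fun k =>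
    (((hhol k).contDiffOn Metric.isOpen_ball).restrict_scalars ℝ).mul (hpow k)
  simp only [kernelR_eq]
  refine isPolyanalyticOn_of_iterate_dbar_eq_zero Metric.isOpen_ball q
    (ContDiffOn.sum fun k _ => hterm k) fun z hz => ?_
  rw [iterate_dbar_sum _ Metric.isOpen_ball (fun k _ => hterm k) q hz]
  refine Finset.sum_eq_zero fun k hk => ?_
  rw [iterate_dbar_holomorphic_mul Metric.isOpen_ball (hhol k) (hpow k) q hz]
  beta_reduce
  rw [iterate_dbar_conj_sub_pow, Nat.descFactorial_eq_zero_iff_lt.2 (Finset.mem_range.1 hk)]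
  simp

end Polarization

end Triholomorphic

/-! ### The kernel as a derivative -/

section Kernel

variable {z₀ : ℂ} {r : ℝ} {Q : ℂ → ℝ} {P : ℂ → ℂ → ℂ}

/-- This makes the exponent explicit as $m(Q(z,w)-Q(w))$, the form in which condition (4) applies.
-/
lemma sub_mul_phase {z w : ℂ} (hd : P z z = Q z) :
    (z - w) * phase Q P z w = P z w - Q w := by
  by_cases hwz : w = z
  · subst hwz
    simp [hd]
  · have : w - z ≠ 0 := sub_ne_zero.2 hwz
    simp only [phase, hwz, if_false]
    field_simp
    ring

/-- On the punctured disk $1/(m(z-w))$ is holomorphic in $w$, hence commutes with $\bar\partial_w$,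
and $\bar\partial\theta\,e^{m(z-w)\theta}$ is this factor times $\bar\partial e^{m(z-w)\theta}$. -/
lemma IsPolarization.iterate_dbar_phase_mul (hP : IsPolarization Q z₀ r P) {m : ℝ} (hm : m ≠ 0)
    {z w : ℂ} (hz : z ∈ Metric.ball z₀ r) (hw : w ∈ Metric.ball z₀ r) (hwz : w ≠ z) (k : ℕ) :
    (dbar^[k] (fun η => dbar (fun ξ => phase Q P z ξ) η * expPhase m Q P z η)) w =
      (m * (z - w))⁻¹ * (dbar^[k + 1] (expPhase m Q P z)) w := by
  have hm' : (m : ℂ) ≠ 0 := by exact_mod_cast hm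
  set U : Set ℂ := Metric.ball z₀ r ∩ {z}ᶜ
  have hU : IsOpen U := Metric.isOpen_ball.inter isOpen_compl_singleton
  have hE : ContDiffOn ℝ ∞ (expPhase m Q P z) (Metric.ball z₀ r) :=
    (hP.isTriholomorphic_expPhase m).contDiffOn_right hz
  have hθ : ContDiffOn ℝ ∞ (phase Q P z) (Metric.ball z₀ r) :=
    hP.isTriholomorphic_phase.contDiffOn_right hz
  have hne : ∀ η ∈ U, z - η ≠ 0 := fun η hη => sub_ne_zero.2 fun h => hη.2 h.symm
  have heq : EqOn (fun η => dbar (fun ξ => phase Q P z ξ) η * expPhase m Q P z η)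
      (fun η => (m * (z - η))⁻¹ * dbar (expPhase m Q P z) η) U := by
    intro η hη
    have hd : DifferentiableAt ℂ (fun w => (m : ℂ) * (z - w)) η := by fun_prop
    have hd' := differentiableAt_of_contDiffOn Metric.isOpen_ball hθ hη.1
    have h1 : dbar (expPhase m Q P z) η =
        expPhase m Q P z η * (m * (z - η) * dbar (phase Q P z) η) := by
      unfold expPhase
      rw [dbar_exp ((hd.restrictScalars ℝ).fun_mul hd'), dbar_mul (hd.restrictScalars ℝ) hd',
        dbar_eq_zero_of_differentiableAt hd]
      ring
    have := hne η hη
    beta_reduce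
    rw [h1]
    field_simp
  have hwU : w ∈ U := ⟨hw, hwz⟩
  rw [iterate_dbar_eqOn hU heq k hwU, iterate_dbar_holomorphic_mul hU (f := dbar (expPhase m Q P z))
    (fun η hη => ?_) ((contDiffOn_dbar Metric.isOpen_ball hE).mono inter_subset_left) k hwU,
    Function.iterate_succ_apply]
  have : (m : ℂ) * (z - η) ≠ 0 := mul_ne_zero hm' (hne η hη)
  have hd : DifferentiableAt ℂ (fun w => (m : ℂ) * (z - w)) η := by fun_prop
  exact (hd.fun_inv this).differentiableWithinAt

/-- Expand the right side by Leibniz: $\bar\partial^{k+1}$ of the exponential meets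
$\bar\partial^{n-k}(\bar w-\bar z)^n=\frac{n!}{k!}(\bar w-\bar z)^k$. The weight
$\binom{n+1}{k+1}\frac{n!}{k!}$ is $n!$ times the kernel's coefficient, $(-1)^k$ reverses $\bar
z-\bar w$, and the overall sign comes from $z-w=-(w-z)$. -/
lemma IsPolarization.kernelR_mul_expPhase (hP : IsPolarization Q z₀ r P) (n : ℕ) {m : ℝ}
    (hm : m ≠ 0) {z w : ℂ} (hz : z ∈ Metric.ball z₀ r) (hw : w ∈ Metric.ball z₀ r) (hwz : w ≠ z) :
    n ! * (kernelR (n + 1) m Q P z w * expPhase m Q P z w) =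
      -((dbar^[n + 1] fun η => (conj η - conj z) ^ n * expPhase m Q P z η) w / (w - z)) := by
  have hm' : (m : ℂ) ≠ 0 := by exact_mod_cast hm
  have hzw : z - w ≠ 0 := sub_ne_zero.2 hwz.symm
  have hwz' : w - z ≠ 0 := sub_ne_zero.2 hwz
  have hE : ContDiffOn ℝ ∞ (expPhase m Q P z) (Metric.ball z₀ r) :=
    (hP.isTriholomorphic_expPhase m).contDiffOn_right hz
  have hpow : ContDiffOn ℝ ∞ (fun η : ℂ => (conj η - conj z) ^ n) (Metric.ball z₀ r) :=
    ((contDiff_conj.sub contDiff_const).pow n).contDiffOn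
  have hcomm : (fun η => (conj η - conj z) ^ n * expPhase m Q P z η) =
      fun η => expPhase m Q P z η * (conj η - conj z) ^ n := by ext; ring
  rw [hcomm, iterate_dbar_mul Metric.isOpen_ball hE hpow (n + 1) hw]
  beta_reduce
  rw [Finset.sum_range_succ' _ (n + 1)]
  simp only [iterate_dbar_conj_sub_pow]
  -- The Leibniz term with no derivative on the exponential vanishes, so the sum starts at
  -- $\bar\partial^1$ and matches the index shift `k + 1`.
  have h0 : n.descFactorial (n + 1 - 0) = 0 := Nat.descFactorial_eq_zero_iff_lt.2 (by omega)
  rw [h0, Nat.cast_zero, zero_mul, mul_zero, mul_zero, add_zero, Finset.sum_div,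
    ← Finset.sum_neg_distrib, kernelR_eq, Finset.sum_mul, Finset.mul_sum]
  refine Finset.sum_congr rfl fun k hk => ?_
  have hk' : k ≤ n := by have := Finset.mem_range.1 hk; omega
  rw [kernelCoeff, hP.iterate_dbar_phase_mul hm hz hw hwz]
  have hexp : Complex.exp (-((m : ℂ) * (z - w) * phase Q P z w)) * expPhase m Q P z w = 1 := by
    rw [expPhase, ← Complex.exp_add, neg_add_cancel, Complex.exp_zero]
  have hdesc : (k ! : ℂ) * n.descFactorial (n - k) = n ! := by
    have := Nat.factorial_mul_descFactorial (Nat.sub_le n k)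
    rw [Nat.sub_sub_self hk'] at this
    exact_mod_cast this
  have hchoose : ((n + 1).choose (k + 1) : ℂ) * (k + 1)! * (n - k)! = (n + 1)! := by
    have := Nat.choose_mul_factorial_mul_factorial (show k + 1 ≤ n + 1 by omega)
    rw [show n + 1 - (k + 1) = n - k by omega] at this
    exact_mod_cast this
  rw [show n + 1 - (k + 1) = n - k by omega, show n + 1 - 1 - k = n - k by omega,
    show n - (n - k) = k by omega, ← hdesc, ← hchoose,
    show conj z - conj w = -1 * (conj w - conj z) by ring, mul_pow]
  have f1 : (k ! : ℂ) ≠ 0 := by exact_mod_cast k.factorial_ne_zero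
  have f2 : ((k + 1)! : ℂ) ≠ 0 := by exact_mod_cast (k + 1).factorial_ne_zero
  have f3 : ((n - k)! : ℂ) ≠ 0 := by exact_mod_cast (n - k).factorial_ne_zero
  have hsq : ((-1 : ℂ) ^ k) * (-1) ^ k = 1 := by rw [← mul_pow]; simp
  generalize Complex.exp (-((m : ℂ) * (z - w) * phase Q P z w)) = X at hexp ⊢
  generalize (dbar^[k + 1] (expPhase m Q P z)) w = Y
  generalize expPhase m Q P z w = Z at hexp ⊢
  generalize (-1 : ℂ) ^ k = σ at hsq ⊢
  rw [show z - w = -(w - z) by ring]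
  generalize w - z = c at hwz' ⊢
  generalize (conj w - conj z) ^ k = B
  field_simp
  generalize ((n + 1).choose (k + 1) : ℂ) = N
  linear_combination (-(Y * N * B * σ ^ 2)) * hexp - (Y * N * B) * hsq

end Kernel

/-! ### Uniform estimates -/

/-- Joint smoothness on `U × U`. -/
def JointSmooth (U : Set ℂ) (F : ℂ → ℂ → ℂ) : Prop :=
  ContDiffOn ℝ ∞ (fun x : ℂ × ℂ => F x.1 x.2) (U ×ˢ U)

namespace JointSmooth

variable {U : Set ℂ} {F G : ℂ → ℂ → ℂ}

lemma mul (hF : JointSmooth U F) (hG : JointSmooth U G) :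
    JointSmooth U fun z w => F z w * G z w := ContDiffOn.mul hF hG

lemma right (hF : JointSmooth U F) {z : ℂ} (hz : z ∈ U) : ContDiffOn ℝ ∞ (F z) U :=
  ContDiffOn.comp (g := fun x : ℂ × ℂ => F x.1 x.2) (f := fun w => (z, w)) hF
    (contDiff_const.prodMk contDiff_id).contDiffOn fun _ hw => ⟨hz, hw⟩

lemma dbar_right (hU : IsOpen U) (hF : JointSmooth U F) :
    JointSmooth U fun z w => dbar (F z) w := by
  have h : ContDiffOn ℝ ∞ (fderiv ℝ fun x : ℂ × ℂ => F x.1 x.2) (U ×ˢ U) :=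
    hF.fderiv_of_isOpen (hU.prod hU) (by simp)
  have h2 : ContDiffOn ℝ ∞ (fun x : ℂ × ℂ => (fderiv ℝ (fun x : ℂ × ℂ => F x.1 x.2) x (0, 1) +
      Complex.I * fderiv ℝ (fun x : ℂ × ℂ => F x.1 x.2) x (0, Complex.I)) / 2) (U ×ˢ U) :=
    ((h.clm_apply contDiffOn_const).add
      (contDiffOn_const.mul (h.clm_apply contDiffOn_const))).div_const 2
  refine h2.congr fun x hx => ?_
  have hd : DifferentiableAt ℝ (fun x : ℂ × ℂ => F x.1 x.2) (x.1, x.2) :=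
    (hF.differentiableOn (by simp)).differentiableAt ((hU.prod hU).mem_nhds hx)
  have hpair : HasFDerivAt (fun w : ℂ => (x.1, w))
      ((0 : ℂ →L[ℝ] ℂ).prod (ContinuousLinearMap.id ℝ ℂ)) x.2 :=
    (hasFDerivAt_const _ _).prodMk (hasFDerivAt_id _)
  have hc : HasFDerivAt (F x.1) _ x.2 :=
    HasFDerivAt.comp (g := fun x : ℂ × ℂ => F x.1 x.2) x.2 hd.hasFDerivAt hpair
  simp only [dbar, hc.fderiv]
  simp

/-- `∂̄_w^j (A e^{m f}) = O(m^j |e^{m f}|)` uniformly on compact sets. -/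
lemma norm_iterate_dbar_mul_exp_le (hU : IsOpen U) {f : ℂ → ℂ → ℂ} (hf : JointSmooth U f)
    {K L : Set ℂ} (hK : IsCompact K) (hL : IsCompact L) (hKU : K ⊆ U) (hLU : L ⊆ U) (j : ℕ)
    {A : ℂ → ℂ → ℂ} (hA : JointSmooth U A) :
    ∃ C : ℝ, 0 ≤ C ∧ ∀ m : ℝ, 1 ≤ m → ∀ z ∈ K, ∀ w ∈ L,
      ‖(dbar^[j] fun η => A z η * Complex.exp (m * f z η)) w‖ ≤
        C * m ^ j * ‖Complex.exp (m * f z w)‖ := by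
  -- The amplitude must be arbitrary: one $\bar\partial$ turns $Ae^{mf}$ into $(\bar\partial
  -- A)e^{mf}+m(A\bar\partial f)e^{mf}$, two terms of the same shape with new amplitudes.
  induction j generalizing A with
  | zero =>
    obtain ⟨C, hC⟩ := (hK.prod hL).exists_bound_of_continuousOn
      (ContDiffOn.continuousOn hA |>.mono (prod_mono hKU hLU))
    refine ⟨max C 0, le_max_right _ _, fun m hm z hz w hw => ?_⟩
    simp only [Function.iterate_zero, id_eq, norm_mul, pow_zero, mul_one]
    gcongr
    exact (hC (z, w) ⟨hz, hw⟩).trans (le_max_left _ _)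
  | succ j ih =>
    obtain ⟨C₁, hC₁, h₁⟩ := ih (hA.dbar_right hU)
    obtain ⟨C₂, hC₂, h₂⟩ := ih (hA.mul (hf.dbar_right hU))
    refine ⟨C₁ + C₂, by positivity, fun m hm z hz w hw => ?_⟩
    have hzU := hKU hz
    have hmf : ContDiffOn ℝ ∞ (fun η => (m : ℂ) * f z η) U := contDiffOn_const.mul (hf.right hzU)
    have hexp : ContDiffOn ℝ ∞ (fun η => Complex.exp (m * f z η)) U := hmf.cexp
    have heq : EqOn (dbar fun η => A z η * Complex.exp (m * f z η))
        (fun η => dbar (A z) η * Complex.exp (m * f z η) +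
          m * (A z η * dbar (f z) η * Complex.exp (m * f z η))) U := by
      intro η hη
      rw [dbar_mul (differentiableAt_of_contDiffOn hU (hA.right hzU) hη)
        (differentiableAt_of_contDiffOn hU hexp hη),
        dbar_exp (differentiableAt_of_contDiffOn hU hmf hη),
        dbar_const_mul _ (differentiableAt_of_contDiffOn hU (hf.right hzU) hη)]
      ring
    have s1 : ContDiffOn ℝ ∞ (fun η => dbar (A z) η * Complex.exp (m * f z η)) U :=
      ((hA.dbar_right hU).right hzU).mul hexp
    have s2 : ContDiffOn ℝ ∞ (fun η => A z η * dbar (f z) η * Complex.exp (m * f z η)) U :=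
      ((hA.mul (hf.dbar_right hU)).right hzU).mul hexp
    rw [Function.iterate_succ_apply, iterate_dbar_eqOn hU heq j (hLU hw),
      iterate_dbar_add hU s1 (contDiffOn_const.mul s2) j (hLU hw)]
    beta_reduce
    rw [iterate_dbar_holomorphic_mul hU (h := fun _ => (m : ℂ)) (differentiableOn_const _) s2 j (hLU hw)]
    refine (norm_add_le _ _).trans ?_
    rw [norm_mul, Complex.norm_real, Real.norm_of_nonneg (by linarith)]
    calc _ ≤ C₁ * m ^ j * ‖Complex.exp (m * f z w)‖ +
          m * (C₂ * m ^ j * ‖Complex.exp (m * f z w)‖) := by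
          gcongr
          · exact h₁ m hm z hz w hw
          · exact h₂ m hm z hz w hw
      _ ≤ C₁ * m ^ (j + 1) * ‖Complex.exp (m * f z w)‖ +
          m * (C₂ * m ^ j * ‖Complex.exp (m * f z w)‖) := by
          gcongr
          omega
      _ = _ := by ring

end JointSmooth

/-! ### Cut-off functions -/

namespace IsCutoff

variable {χ₀ : ℝ → ℝ}

/-- The closed support is a compact subset of an open interval, so it leaves a margin. This yields a
closed disk inside the open one on which constants are uniform in `w`. -/
lemma exists_radius (h : IsCutoff χ₀) : ∃ s : ℝ, 0 ≤ s ∧ s < 1 ∧ ∀ t, s < |t| → χ₀ t = 0 := by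
  have hK : IsCompact (tsupport χ₀) :=
    (isCompact_Icc (a := (-1 : ℝ)) (b := 1)).of_isClosed_subset (isClosed_tsupport _)
      (h.support.trans Ioo_subset_Icc_self)
  have h0 : χ₀ 0 = 1 := h.eq_one 0 (by constructor <;> norm_num)
  have hne : (tsupport χ₀).Nonempty := ⟨0, subset_tsupport _ (by simp [h0])⟩
  obtain ⟨t, ht, hmax⟩ := hK.exists_isMaxOn hne continuous_abs.continuousOn
  refine ⟨|t|, abs_nonneg _, abs_lt.2 (h.support ht), fun x hx => ?_⟩
  by_contra hx0
  exact absurd (hmax (subset_tsupport _ hx0)) (not_le.2 hx)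

/-- The norm is not smooth at the centre, but the cut-off is constant near it. -/
lemma contDiff (h : IsCutoff χ₀) {r : ℝ} (hr : 0 < r) (z₀ : ℂ) :
    ContDiff ℝ ∞ (fun w : ℂ => (χ₀ (‖w - z₀‖ / r) : ℂ)) := by
  refine Complex.ofRealCLM.contDiff.comp (contDiff_iff_contDiffAt.2 fun w => ?_)
  by_cases hw : w = z₀
  · subst hw
    refine (contDiffAt_const (c := (1 : ℝ))).congr_of_eventuallyEq ?_
    filter_upwards [Metric.ball_mem_nhds w (show 0 < 2 / 3 * r by positivity)] with x hx
    refine h.eq_one _ ⟨?_, ?_⟩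
    · exact lt_of_lt_of_le (by norm_num) (show (0 : ℝ) ≤ ‖x - w‖ / r by positivity)
    · rw [div_lt_iff₀ hr]
      simpa [dist_eq_norm] using hx
  · have hn : ContDiffAt ℝ ∞ (fun w : ℂ => ‖w - z₀‖ / r) w :=
      ((contDiffAt_id.sub contDiffAt_const).norm ℝ (sub_ne_zero.2 hw)).div_const r
    exact ContDiffAt.comp w h.smooth.contDiffAt hn

end IsCutoff

/-! ### The approximate reproducing identity -/

/-- This is Cauchy-Schwarz against the constant function 1 on `K`. -/
lemma setIntegral_le_sqrt_mul_sqrt {K : Set ℂ} (hK : IsCompact K) {v : ℂ → ℝ}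
    (hv : Continuous v) (hv0 : ∀ w, 0 ≤ v w) (hvi : Integrable (fun w => v w ^ 2) area) :
    ∫ w in K, v w ∂area ≤ √(∫ w, v w ^ 2 ∂area) * √(area.real K) := by
  have : IsFiniteMeasure (area.restrict K) := ⟨by simpa using hK.measure_lt_top⟩
  have h2 : MemLp v (ENNReal.ofReal 2) (area.restrict K) := by
    rw [ENNReal.ofReal_ofNat]
    exact (memLp_two_iff_integrable_sq hv.aestronglyMeasurable).2 hvi.integrableOn
  have h := integral_mul_le_Lp_mul_Lq_of_nonneg Real.HolderConjugate.two_two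
    (μ := area.restrict K) (f := v) (g := fun _ => 1) (.of_forall hv0)
    (.of_forall fun _ => zero_le_one) h2 (memLp_const 1)
  simp only [mul_one, ← Real.sqrt_eq_rpow, Real.rpow_ofNat, one_pow] at h
  refine h.trans ?_
  have h3 : ∫ _ in K, (1 : ℝ) ∂area = area.real K := by simp
  rw [h3]
  exact mul_le_mul_of_nonneg_right (Real.sqrt_le_sqrt
    (setIntegral_le_integral hvi (.of_forall fun w => sq_nonneg (v w)))) (Real.sqrt_nonneg _)

section Reproducing

variable {z₀ : ℂ} {r : ℝ} {Q : ℂ → ℝ} {P : ℂ → ℂ → ℂ} {χ₀ : ℝ → ℝ}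

/-- Halving condition (4) gives $\operatorname{Re}Q(z,w)-Q(w)\le\frac12(Q(z)-Q(w))-\frac14\Delta
Q(z_0)|w-z|^2$. The factor $e^{-mQ(w)/2}$ is kept apart to be absorbed into the norm of `u`. -/
lemma IsAdmissible.norm_expPhase_le (hA : IsAdmissible Q z₀ r P) {m : ℝ} (hm : 0 ≤ m) {z w : ℂ}
    (hz : z ∈ Metric.ball z₀ r) (hw : w ∈ Metric.ball z₀ r) :
    ‖expPhase m Q P z w‖ ≤
      Real.exp (m * Q z / 2 - m * (lap Q z₀ / 4 * ‖w - z‖ ^ 2)) * Real.exp (-m * Q w / 2) := by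
  rw [expPhase, mul_assoc, sub_mul_phase (hA.polar.diag z hz), Complex.norm_exp, ← Real.exp_add]
  refine Real.exp_le_exp.2 ?_
  have h := hA.bound z hz w hw
  rw [Complex.re_ofReal_mul, Complex.sub_re, Complex.ofReal_re]
  nlinarith [mul_le_mul_of_nonneg_left h hm]

/-- The commutator of `∂̄^{n+1}` with the cut-off function, applied to `(w̄ - z̄)^n e^{m(z-w)θ}`. -/
def cutoffError (n : ℕ) (m : ℝ) (Q : ℂ → ℝ) (P : ℂ → ℂ → ℂ) (χ : ℂ → ℂ) (z w : ℂ) : ℂ :=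
  (dbar^[n + 1] fun η => (conj η - conj z) ^ n * (χ η * expPhase m Q P z η)) w -
    χ w * (dbar^[n + 1] fun η => (conj η - conj z) ^ n * expPhase m Q P z η) w

lemma cutoffError_eq_zero_of_eqOn_const (n : ℕ) (m : ℝ) {χ : ℂ → ℂ} (z : ℂ) {w : ℂ} {V : Set ℂ}
    (hV : IsOpen V) (hw : w ∈ V) (hχ : EqOn χ 1 V) : cutoffError n m Q P χ z w = 0 := by
  have h : EqOn (fun η => (conj η - conj z) ^ n * (χ η * expPhase m Q P z η))
      (fun η => (conj η - conj z) ^ n * expPhase m Q P z η) V := fun η hη => by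
    simp [hχ hη]
  rw [cutoffError, iterate_dbar_eqOn hV h (n + 1) hw, hχ hw]
  simp

lemma iterate_dbar_zero (n : ℕ) (w : ℂ) : (dbar^[n] fun _ => 0) w = 0 := by
  induction n generalizing w with
  | zero => rfl
  | succ n ih => rw [Function.iterate_succ_apply', funext ih, dbar_const]

lemma cutoffError_eq_zero_of_eqOn_zero (n : ℕ) (m : ℝ) {χ : ℂ → ℂ} (z : ℂ) {w : ℂ} {V : Set ℂ}
    (hV : IsOpen V) (hw : w ∈ V) (hχ : EqOn χ 0 V) : cutoffError n m Q P χ z w = 0 := by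
  have h : EqOn (fun η => (conj η - conj z) ^ n * (χ η * expPhase m Q P z η))
      (fun _ => 0) V := fun η hη => by
    simp [hχ hη]
  rw [cutoffError, iterate_dbar_eqOn hV h (n + 1) hw, hχ hw, iterate_dbar_zero]
  simp

/-- The two halves of the commutator are bounded separately, since no cancellation is needed: the
exponential will be small wherever the commutator is nonzero. -/
lemma IsAdmissible.norm_cutoffError_le (hA : IsAdmissible Q z₀ r P) (n : ℕ) {χ : ℂ → ℂ}
    (hχ : ContDiff ℝ ∞ χ) {K L : Set ℂ} (hK : IsCompact K) (hL : IsCompact L)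
    (hKU : K ⊆ Metric.ball z₀ r) (hLU : L ⊆ Metric.ball z₀ r) :
    ∃ C : ℝ, 0 ≤ C ∧ ∀ m : ℝ, 1 ≤ m → ∀ z ∈ K, ∀ w ∈ L,
      ‖cutoffError n m Q P χ z w‖ ≤ C * m ^ (n + 1) * ‖expPhase m Q P z w‖ := by
  have hf : JointSmooth (Metric.ball z₀ r) fun z w => (z - w) * phase Q P z w :=
    (IsTriholomorphic.fst_sub_snd.mul hA.polar.isTriholomorphic_phase).analyticOnNhd.contDiffOn
      (Metric.isOpen_ball.prod Metric.isOpen_ball).uniqueDiffOn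
  have hb : JointSmooth (Metric.ball z₀ r) fun z w => (conj w - conj z) ^ n :=
    ((contDiff_conj.comp contDiff_snd).sub (contDiff_conj.comp contDiff_fst)
      |>.pow n).contDiffOn
  have hc : JointSmooth (Metric.ball z₀ r) fun _ w => χ w := (hχ.comp contDiff_snd).contDiffOn
  obtain ⟨C₁, hC₁, h₁⟩ := JointSmooth.norm_iterate_dbar_mul_exp_le Metric.isOpen_ball hf hK hL hKU
    hLU (n + 1) (hb.mul hc)
  obtain ⟨C₂, hC₂, h₂⟩ := JointSmooth.norm_iterate_dbar_mul_exp_le Metric.isOpen_ball hf hK hL hKU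
    hLU (n + 1) hb
  obtain ⟨M, hM⟩ := hL.exists_bound_of_continuousOn hχ.continuous.continuousOn
  refine ⟨C₁ + |M| * C₂, by positivity, fun m hm z hz w hw => ?_⟩
  have hE : ∀ η, expPhase m Q P z η = Complex.exp (m * ((z - η) * phase Q P z η)) := fun η => by
    rw [expPhase, mul_assoc]
  simp only [cutoffError, hE, ← mul_assoc ((conj _ - conj z) ^ n)]
  refine (norm_sub_le _ _).trans ?_
  rw [norm_mul (χ w)]
  calc _ ≤ C₁ * m ^ (n + 1) * ‖Complex.exp (m * ((z - w) * phase Q P z w))‖ +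
        |M| * (C₂ * m ^ (n + 1) * ‖Complex.exp (m * ((z - w) * phase Q P z w))‖) := by
        gcongr
        · exact h₁ m hm z hz w hw
        · exact (hM w hw).trans (le_abs_self M)
        · exact h₂ m hm z hz w hw
    _ = _ := by ring

/-- The approximate reproducing identity, with the error written as an integral. -/
lemma IsAdmissible.sub_integral_eq (hA : IsAdmissible Q z₀ r P) (n : ℕ) {m : ℝ} (hm : m ≠ 0)
    {u : ℂ → ℂ} (hu : IsPolyanalyticOn (n + 1) u univ) {χ : ℂ → ℂ} (hχ : ContDiff ℝ ∞ χ)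
    (hχc : HasCompactSupport χ) (hχU : tsupport χ ⊆ Metric.ball z₀ r) {z : ℂ}
    (hz : z ∈ Metric.ball z₀ r) (hχz : χ z = 1) :
    IntegrableOn (fun w => u w * χ w * kernelR (n + 1) m Q P z w * expPhase m Q P z w)
      (Metric.ball z₀ r) area ∧
    u z - ∫ w in Metric.ball z₀ r, u w * χ w * kernelR (n + 1) m Q P z w * expPhase m Q P z w
      ∂area = -(n ! : ℂ)⁻¹ * ∫ w in Metric.ball z₀ r,
        u w * cutoffError n m Q P χ z w / (w - z) ∂area := by
  have huc : Continuous u := continuousOn_univ.1 hu.1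
  have hU : IsOpen (Metric.ball z₀ r) := Metric.isOpen_ball
  have hE : ContDiffOn ℝ ∞ (expPhase m Q P z) (Metric.ball z₀ r) :=
    (hA.polar.isTriholomorphic_expPhase m).contDiffOn_right hz
  have hg : ContDiff ℝ ∞ (fun w => χ w * expPhase m Q P z w) := by
    refine contDiff_iff_contDiffAt.2 fun w => ?_
    by_cases hw : w ∈ tsupport χ
    · exact hχ.contDiffAt.mul (hE.contDiffAt (hU.mem_nhds (hχU hw)))
    · refine (contDiffAt_const (c := (0 : ℂ))).congr_of_eventuallyEq ?_
      filter_upwards [notMem_tsupport_iff_eventuallyEq.1 hw] with x hx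
      simp [hx]
  have hgc : HasCompactSupport (fun w => χ w * expPhase m Q P z w) := hχc.mul_right
  obtain ⟨hInt, heq⟩ := integral_mul_iterate_dbar_div n hu hg hgc z
  have hE1 : expPhase m Q P z z = 1 := by simp [expPhase]
  rw [hχz, hE1, mul_one, mul_one] at heq
  have hJ : Integrable
      (fun w => u w * χ w * kernelR (n + 1) m Q P z w * expPhase m Q P z w) area := by
    have hc : Continuous (fun w => (kernelR (n + 1) m Q P z w * expPhase m Q P z w) *
        (u w * χ w)) :=
      continuous_mul_of_tsupport_subset hU
        ((hA.polar.analyticOnNhd_kernelR (n + 1) m hz).continuousOn.mul hE.continuousOn)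
        (huc.mul hχ.continuous)
        ((closure_mono (Function.support_mul_subset_right u χ)).trans hχU)
    refine (hc.integrable_of_hasCompactSupport (hχc.mul_left.mul_left)).congr (.of_forall fun w => ?_)
    ring
  refine ⟨hJ.integrableOn, ?_⟩
  have hn : (n ! : ℂ) ≠ 0 := by exact_mod_cast n.factorial_ne_zero
  have hfull : ∫ w in Metric.ball z₀ r, u w *
      (dbar^[n + 1] fun η => (conj η - conj z) ^ n * (χ η * expPhase m Q P z η)) w / (w - z) ∂area =
      -(n ! * u z) := by
    rw [← heq]
    refine setIntegral_eq_integral_of_forall_compl_eq_zero fun w hw => ?_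
    have : w ∉ tsupport fun η => (conj η - conj z) ^ n * (χ η * expPhase m Q P z η) := fun h =>
      hw (hχU (closure_mono ((Function.support_mul_subset_right _ _).trans
        (Function.support_mul_subset_left _ _)) h))
    rw [image_eq_zero_of_notMem_tsupport (fun h => this (tsupport_iterate_dbar_subset _ _ h))]
    simp
  have hne : ∀ᵐ w ∂(area.restrict (Metric.ball z₀ r)), w ≠ z := by
    have h : ∀ᵐ w ∂(volume : Measure ℂ), w ≠ z := by
      simp [ae_iff]
    exact ae_restrict_of_ae ((Measure.ae_smul_measure_le _) h)
  -- Off the null set $\{z\}$ the part of the commutator not involving derivatives of $\chi$ is, by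
  -- the kernel identity, a multiple of the reproducing integrand.
  have hcongr : ∫ w in Metric.ball z₀ r, u w * cutoffError n m Q P χ z w / (w - z) ∂area =
      ∫ w in Metric.ball z₀ r, (u w *
        (dbar^[n + 1] fun η => (conj η - conj z) ^ n * (χ η * expPhase m Q P z η)) w / (w - z) +
        n ! * (u w * χ w * kernelR (n + 1) m Q P z w * expPhase m Q P z w)) ∂area := by
    refine integral_congr_ae ?_
    filter_upwards [hne, ae_restrict_mem hU.measurableSet] with w hwz hw
    have := hA.polar.kernelR_mul_expPhase n hm hz hw hwz
    rw [cutoffError]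
    linear_combination -(u w * χ w) * this
  rw [hcongr, integral_add hInt.integrableOn (hJ.integrableOn.const_mul _), integral_const_mul,
    hfull]
  field_simp
  ring

theorem IsAdmissible.approximate_reproducing (hA : IsAdmissible Q z₀ r P) (hQ : Continuous Q)
    (hpos : 0 < lap Q z₀) (n : ℕ) (hχ : IsCutoff χ₀) :
    ∃ δ : ℝ, 0 < δ ∧ ∃ C : ℝ, 0 < C ∧ ∀ m : ℝ, 1 ≤ m → ∀ u : ℂ → ℂ, MemA2 (n + 1) m Q u →
      ∀ z ∈ Metric.ball z₀ (r / 3),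
        IntegrableOn
          (fun w => u w * (χ₀ (‖w - z₀‖ / r) : ℂ) * kernelR (n + 1) m Q P z w *
            expPhase m Q P z w) (Metric.ball z₀ r) area ∧
        ‖u z - ∫ w in Metric.ball z₀ r, u w * (χ₀ (‖w - z₀‖ / r) : ℂ) *
            kernelR (n + 1) m Q P z w * expPhase m Q P z w ∂area‖
          ≤ C * wnorm m Q u * Real.exp (m * Q z / 2 - δ * m) := by
  have hr := hA.pos
  obtain ⟨s, hs0, hs1, hs⟩ := hχ.exists_radius
  have hsr : s * r < r := by nlinarith
  let χ : ℂ → ℂ := fun w => (χ₀ (‖w - z₀‖ / r) : ℂ)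
  have hχs : ContDiff ℝ ∞ χ := hχ.contDiff hr z₀
  let L : Set ℂ := Metric.closedBall z₀ (s * r)
  have hL : IsCompact L := isCompact_closedBall _ _
  have hLU : L ⊆ Metric.ball z₀ r := Metric.closedBall_subset_ball hsr
  have hχ0 : EqOn χ 0 Lᶜ := by
    intro w hw
    have hw' : s * r < ‖w - z₀‖ := by simpa [L, dist_eq_norm] using hw
    have : χ₀ (‖w - z₀‖ / r) = 0 := by
      refine hs _ ?_
      rw [abs_of_nonneg (by positivity), lt_div_iff₀ hr]
      exact hw'
    simp [χ, this]
  have hχ1 : EqOn χ 1 (Metric.ball z₀ (2 / 3 * r)) := by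
    intro w hw
    have : χ₀ (‖w - z₀‖ / r) = 1 := by
      refine hχ.eq_one _ ⟨?_, ?_⟩
      · exact lt_of_lt_of_le (by norm_num) (show (0 : ℝ) ≤ ‖w - z₀‖ / r by positivity)
      · rw [div_lt_iff₀ hr]
        simpa [dist_eq_norm] using hw
    simp [χ, this]
  have hχL : tsupport χ ⊆ L := closure_minimal
    (fun w hw => by_contra fun h => hw (hχ0 h)) Metric.isClosed_closedBall
  have hχc : HasCompactSupport χ := HasCompactSupport.of_support_subset_isCompact hL
    (subset_closure.trans hχL)
  obtain ⟨C₁, hC₁, hbound⟩ := hA.norm_cutoffError_le n hχs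
    (isCompact_closedBall z₀ (r / 3)) hL (Metric.closedBall_subset_ball (by linarith)) hLU
  -- For $|w-z|\ge r/3$ the Gaussian exponent is at least $\frac14\Delta Q(z_0)(r/3)^2=2\delta$ per
  -- unit of $m$. One $\delta$ absorbs $m^{n+1}$ through
  -- $m^{n+1}\le\frac{(n+1)!}{\delta^{n+1}}e^{\delta m}$; the other remains in the conclusion.
  set δ : ℝ := lap Q z₀ * r ^ 2 / 72 with hδ
  have hδ0 : 0 < δ := by positivity
  set B : ℝ := C₁ * (3 / r) * ((n + 1)! / δ ^ (n + 1)) with hB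
  have hB0 : 0 ≤ B := by positivity
  -- Adding 1 only serves to make the constant strictly positive.
  refine ⟨δ, hδ0, B * √(area.real L) + 1, by positivity, fun m hm u hu z hz => ?_⟩
  have hm0 : 0 < m := by linarith
  have hzr : z ∈ Metric.ball z₀ r := Metric.ball_subset_ball (by linarith) hz
  have huc : Continuous u := continuousOn_univ.1 hu.1.1
  obtain ⟨hInt, heq⟩ := hA.sub_integral_eq n hm0.ne' hu.1 hχs hχc (hχL.trans hLU) hzr
    (hχ1 (Metric.ball_subset_ball (by linarith) hz))
  refine ⟨hInt, ?_⟩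
  rw [heq, norm_mul, norm_neg, norm_inv, Complex.norm_natCast]
  let v : ℂ → ℝ := fun w => ‖u w‖ * Real.exp (-m * Q w / 2)
  have hv : Continuous v := by fun_prop
  have hv2 : ∀ w, v w ^ 2 = ‖u w‖ ^ 2 * Real.exp (-m * Q w) := fun w => by
    simp only [v, mul_pow, ← Real.exp_nat_mul]
    congr 2
    push_cast
    ring
  have hvi : Integrable (fun w => v w ^ 2) area := by
    simp only [hv2]
    exact hu.2
  have hwn : √(∫ w, v w ^ 2 ∂area) = wnorm m Q u := by simp only [hv2, wnorm]
  have hmpow : m ^ (n + 1) ≤ (n + 1)! / δ ^ (n + 1) * Real.exp (δ * m) := by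
    have h := Real.pow_div_factorial_le_exp (δ * m) (by positivity) (n + 1)
    rw [div_le_iff₀ (by positivity), mul_pow] at h
    rw [div_mul_eq_mul_div, le_div_iff₀ (by positivity)]
    linarith
  set T : ℝ := Real.exp (m * Q z / 2 - δ * m) with hT
  have hpt : ∀ w ∈ Metric.ball z₀ r, ‖u w * cutoffError n m Q P χ z w / (w - z)‖ ≤
      L.indicator (fun w => B * T * v w) w := by
    intro w hw
    by_cases hwL : w ∈ L
    · rw [indicator_of_mem hwL]
      by_cases hw1 : w ∈ Metric.ball z₀ (2 / 3 * r)
      · rw [cutoffError_eq_zero_of_eqOn_const n m z Metric.isOpen_ball hw1 hχ1]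
        simp only [mul_zero, zero_div, norm_zero]
        positivity
      · have hdist : r / 3 ≤ ‖w - z‖ := by
          have h1 : 2 / 3 * r ≤ dist w z₀ := by simpa using hw1
          have h2 : dist z z₀ < r / 3 := hz
          have h3 := dist_triangle w z z₀
          rw [← dist_eq_norm]
          linarith
        have h1 := hbound m hm z (Metric.ball_subset_closedBall hz) w hwL
        have h2 := hA.norm_expPhase_le hm0.le hzr hw
        have h3 : Real.exp (m * Q z / 2 - m * (lap Q z₀ / 4 * ‖w - z‖ ^ 2)) ≤
            T * Real.exp (-(δ * m)) := by
          rw [hT, ← Real.exp_add]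
          refine Real.exp_le_exp.2 ?_
          have : (r / 3) ^ 2 ≤ ‖w - z‖ ^ 2 := by gcongr
          have : 2 * δ ≤ lap Q z₀ / 4 * ‖w - z‖ ^ 2 := by
            rw [hδ]
            nlinarith
          nlinarith
        rw [norm_div, norm_mul]
        calc ‖u w‖ * ‖cutoffError n m Q P χ z w‖ / ‖w - z‖
            ≤ ‖u w‖ * (C₁ * ((n + 1)! / δ ^ (n + 1) * Real.exp (δ * m)) *
              (T * Real.exp (-(δ * m)) * Real.exp (-m * Q w / 2))) / (r / 3) := by
              gcongr
              refine h1.trans ?_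
              gcongr
              refine h2.trans ?_
              gcongr
          _ = B * T * v w * (Real.exp (δ * m) * Real.exp (-(δ * m))) := by
              simp only [hB, v]
              field_simp
          _ = B * T * v w := by rw [← Real.exp_add]; simp
    · rw [cutoffError_eq_zero_of_eqOn_zero n m z Metric.isClosed_closedBall.isOpen_compl hwL hχ0]
      simp [indicator_of_notMem hwL]
  have hind : Integrable (L.indicator (fun w => B * T * v w)) area :=
    (integrable_indicator_iff hL.measurableSet).2
      ((continuous_const.mul hv).continuousOn.integrableOn_compact hL)
  have h1 : ‖∫ w in Metric.ball z₀ r, u w * cutoffError n m Q P χ z w / (w - z) ∂area‖ ≤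
      B * T * ∫ w in L, v w ∂area := by
    refine (norm_integral_le_of_norm_le hind.integrableOn
      ((ae_restrict_iff' measurableSet_ball).2 (.of_forall hpt))).trans_eq ?_
    rw [setIntegral_indicator hL.measurableSet, inter_eq_right.2 hLU, integral_const_mul]
  have h2 := setIntegral_le_sqrt_mul_sqrt hL hv (fun w => by positivity) hvi
  rw [hwn] at h2
  have hw0 : 0 ≤ wnorm m Q u := Real.sqrt_nonneg _
  have hfac : ((n ! : ℝ))⁻¹ ≤ 1 := inv_le_one_of_one_le₀ (by exact_mod_cast n.factorial_pos)
  calc _ ≤ 1 * (B * T * (wnorm m Q u * √(area.real L))) := by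
        gcongr
        exact h1.trans (by gcongr)
    _ = B * √(area.real L) * wnorm m Q u * T := by ring
    _ ≤ _ := by
        gcongr
        linarith

end Reproducing

/-! ### Existence of a polarization -/

/-- The holomorphic continuation `(a + b) / 2` of the real part. -/
def reExt : ℂ × ℂ →L[ℂ] ℂ :=
  (1 / 2 : ℂ) • (ContinuousLinearMap.fst ℂ ℂ ℂ + ContinuousLinearMap.snd ℂ ℂ ℂ)

/-- The holomorphic continuation `(a - b) / 2i` of the imaginary part. -/
def imExt : ℂ × ℂ →L[ℂ] ℂ :=
  (1 / (2 * Complex.I)) • (ContinuousLinearMap.fst ℂ ℂ ℂ - ContinuousLinearMap.snd ℂ ℂ ℂ)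

lemma reExt_apply (v : ℂ × ℂ) : reExt v = (v.1 + v.2) / 2 := by
  simp [reExt]; ring

lemma imExt_apply (v : ℂ × ℂ) : imExt v = (v.1 - v.2) / (2 * Complex.I) := by
  simp only [imExt, FunLike.coe_smul, Pi.smul_apply, FunLike.coe_sub,
    Pi.sub_apply, ContinuousLinearMap.coe_fst', ContinuousLinearMap.coe_snd', smul_eq_mul]
  ring

lemma reExt_conj (w : ℂ) : reExt (w, conj w) = w.re := by
  rw [reExt_apply, Complex.re_eq_add_conj]

lemma imExt_conj (w : ℂ) : imExt (w, conj w) = w.im := by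
  rw [imExt_apply, Complex.im_eq_sub_conj]

lemma conj_reExt (a b : ℂ) : conj (reExt (a, b)) = reExt (conj b, conj a) := by
  simp only [reExt_apply, map_div₀, map_add, Complex.conj_ofNat]
  rw [add_comm]

lemma conj_imExt (a b : ℂ) : conj (imExt (a, b)) = imExt (conj b, conj a) := by
  simp only [imExt_apply, map_div₀, map_sub, map_mul, Complex.conj_I, Complex.conj_ofNat]
  rw [mul_neg, div_neg, ← neg_div, neg_sub]

lemma norm_reExt_le : ‖reExt‖ ≤ 1 := by
  refine ContinuousLinearMap.opNorm_le_bound _ zero_le_one fun v => ?_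
  rw [reExt_apply, norm_div, Complex.norm_ofNat, one_mul, div_le_iff₀ two_pos]
  linarith [norm_add_le v.1 v.2, norm_fst_le v, norm_snd_le v]

lemma norm_imExt_le : ‖imExt‖ ≤ 1 := by
  refine ContinuousLinearMap.opNorm_le_bound _ zero_le_one fun v => ?_
  rw [imExt_apply, norm_div, norm_mul, Complex.norm_I, Complex.norm_ofNat, one_mul, mul_one,
    div_le_iff₀ two_pos]
  linarith [norm_sub_le v.1 v.2, norm_fst_le v, norm_snd_le v]

/-- The holomorphic continuation in `(w, w̄)` of a real multilinear form. -/
def complexify {n : ℕ} (T : ContinuousMultilinearMap ℝ (fun _ : Fin n => ℂ) ℝ) :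
    ContinuousMultilinearMap ℂ (fun _ : Fin n => ℂ × ℂ) ℂ :=
  ∑ s : Finset (Fin n), ((T fun i => if i ∈ s then 1 else Complex.I : ℝ) : ℂ) •
    (ContinuousMultilinearMap.mkPiAlgebra ℂ (Fin n) ℂ).compContinuousLinearMap
      fun i => if i ∈ s then reExt else imExt

lemma complexify_apply {n : ℕ} (T : ContinuousMultilinearMap ℝ (fun _ : Fin n => ℂ) ℝ)
    (v : Fin n → ℂ × ℂ) : complexify T v = ∑ s : Finset (Fin n),
      ((T fun i => if i ∈ s then 1 else Complex.I : ℝ) : ℂ) *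
        ∏ i, if i ∈ s then reExt (v i) else imExt (v i) := by
  simp only [complexify, sum_apply, smul_apply,
    ContinuousMultilinearMap.compContinuousLinearMap_apply,
    ContinuousMultilinearMap.mkPiAlgebra_apply, smul_eq_mul]
  refine Finset.sum_congr rfl fun s _ => ?_
  congr 1
  refine Finset.prod_congr rfl fun i _ => ?_
  split_ifs <;> rfl

lemma complexify_conj {n : ℕ} (T : ContinuousMultilinearMap ℝ (fun _ : Fin n => ℂ) ℝ) (w : ℂ) :
    complexify T (fun _ => (w, conj w)) = (T fun _ => w : ℝ) := by
  have h : (fun _ : Fin n => w) =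
      (fun _ => w.re • (1 : ℂ)) + fun _ => w.im • Complex.I := by
    ext1 i
    simp
  have h2 : T (fun _ : Fin n => w) = ∑ s : Finset (Fin n),
      (∏ i, if i ∈ s then w.re else w.im) * T fun i => if i ∈ s then 1 else Complex.I := by
    conv_lhs => rw [h]
    rw [T.map_add_univ]
    refine Finset.sum_congr rfl fun s _ => ?_
    rw [← smul_eq_mul, ← T.map_smul_univ]
    congr 1
    ext1 i
    by_cases hi : i ∈ s <;> simp [hi]
  rw [complexify_apply, h2]
  push_cast
  refine Finset.sum_congr rfl fun s _ => ?_
  rw [mul_comm]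
  congr 1
  refine Finset.prod_congr rfl fun i _ => ?_
  rw [reExt_conj, imExt_conj]
  split_ifs <;> rfl

lemma conj_complexify {n : ℕ} (T : ContinuousMultilinearMap ℝ (fun _ : Fin n => ℂ) ℝ) (a b : ℂ) :
    conj (complexify T fun _ => (a, b)) = complexify T fun _ => (conj b, conj a) := by
  simp only [complexify_apply, map_sum, map_mul, map_prod, Complex.conj_ofReal]
  refine Finset.sum_congr rfl fun s _ => ?_
  congr 1
  refine Finset.prod_congr rfl fun i _ => ?_
  split_ifs
  · exact conj_reExt a b
  · exact conj_imExt a b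

lemma norm_complexify_le {n : ℕ} (T : ContinuousMultilinearMap ℝ (fun _ : Fin n => ℂ) ℝ) :
    ‖complexify T‖ ≤ 2 ^ n * ‖T‖ := by
  have h : ∀ s ∈ (Finset.univ : Finset (Finset (Fin n))),
      ‖((T fun i => if i ∈ s then 1 else Complex.I : ℝ) : ℂ) •
        (ContinuousMultilinearMap.mkPiAlgebra ℂ (Fin n) ℂ).compContinuousLinearMap
          fun i => if i ∈ s then reExt else imExt‖ ≤ ‖T‖ := by
    intro s _
    rw [norm_smul, Complex.norm_real]
    have h1 : ‖T fun i => if i ∈ s then 1 else Complex.I‖ ≤ ‖T‖ := by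
      refine (T.le_opNorm _).trans_eq ?_
      rw [Finset.prod_eq_one, mul_one]
      intro i _
      split_ifs <;> simp
    have h2 : ‖(ContinuousMultilinearMap.mkPiAlgebra ℂ (Fin n) ℂ).compContinuousLinearMap
          fun i => if i ∈ s then reExt else imExt‖ ≤ 1 := by
      refine (ContinuousMultilinearMap.norm_compContinuousLinearMap_le _ _).trans ?_
      rw [ContinuousMultilinearMap.norm_mkPiAlgebra, one_mul]
      refine Finset.prod_le_one (fun _ _ => norm_nonneg _) fun i _ => ?_
      split_ifs
      · exact norm_reExt_le
      · exact norm_imExt_le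
    calc _ ≤ ‖T‖ * 1 := by gcongr
      _ = ‖T‖ := mul_one _
  refine (norm_sum_le_of_le _ h).trans_eq ?_
  simp [Finset.card_univ]

/-- A real-analytic function near `z₀` is the restriction to `b = w̄` of a holomorphic function,
symmetric under `(a, b) ↦ (b̄, ā)`. -/
lemma exists_holomorphic_extension {Q : ℂ → ℝ} {z₀ : ℂ} (han : AnalyticAt ℝ Q z₀) :
    ∃ p : ℂ × ℂ → ℂ, AnalyticAt ℂ p (z₀, conj z₀) ∧ (∀ᶠ w in 𝓝 z₀, p (w, conj w) = Q w) ∧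
      ∀ a b, conj (p (a, b)) = p (conj b, conj a) := by
  obtain ⟨T, R, hT⟩ := han
  let pc : FormalMultilinearSeries ℂ (ℂ × ℂ) ℂ := fun n => complexify (T n)
  obtain ⟨s, hs0, hsR⟩ := ENNReal.lt_iff_exists_nnreal_btwn.1 hT.r_pos
  have hsum : Summable fun n => ‖T n‖ * (s : ℝ) ^ n :=
    T.summable_norm_mul_pow (hsR.trans_le hT.r_le)
  have hrad : 0 < pc.radius := by
    -- Complexifying a form of degree `n` may multiply its norm by $2^n$, which halving the radius
    -- compensates.
    have h : ((s / 2 : NNReal) : ENNReal) ≤ pc.radius := by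
      refine pc.le_radius_of_summable (hsum.of_nonneg_of_le (fun n => by positivity) fun n => ?_)
      refine (mul_le_mul_of_nonneg_right (norm_complexify_le (T n)) (by positivity)).trans_eq ?_
      push_cast
      rw [div_pow]
      field_simp
    refine lt_of_lt_of_le ?_ h
    have : (0 : NNReal) < s := by exact_mod_cast hs0
    exact_mod_cast half_pos this
  have hpc := pc.hasFPowerSeriesOnBall hrad
  refine ⟨fun x => pc.sum (x - (z₀, conj z₀)), ?_, ?_, fun a b => ?_⟩
  · have h1 : AnalyticAt ℂ pc.sum ((z₀, conj z₀) - (z₀, conj z₀)) := by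
      rw [sub_self]
      exact hpc.analyticAt
    exact AnalyticAt.comp (g := pc.sum) (f := fun x => x - (z₀, conj z₀)) h1
      (analyticAt_id.sub analyticAt_const)
  · filter_upwards [Metric.eball_mem_nhds z₀ hT.r_pos] with w hw
    have hw' : w - z₀ ∈ Metric.eball (0 : ℂ) R := by
      simpa [edist_eq_enorm_sub] using hw
    have h := hT.hasSum hw'
    rw [add_sub_cancel] at h
    have h2 : HasSum (fun n => pc n fun _ => (w, conj w) - (z₀, conj z₀)) (Q w : ℂ) := by
      have := Complex.hasSum_ofReal.2 h
      refine this.congr_fun fun n => ?_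
      rw [Prod.mk_sub_mk, ← map_sub]
      exact complexify_conj (T n) (w - z₀)
    exact h2.tsum_eq
  · simp only [FormalMultilinearSeries.sum, Complex.conj_tsum, Prod.mk_sub_mk, pc, conj_complexify,
      map_sub, Complex.conj_conj]

/-! ### Small radii are admissible -/

/-- The derivative of `p` in its second variable. -/
def derivSnd (p : ℂ × ℂ → ℂ) (x : ℂ × ℂ) : ℂ := fderiv ℂ p x (0, 1)

/-- The mixed derivative of `p`. -/
def derivMixed (p : ℂ × ℂ → ℂ) (x : ℂ × ℂ) : ℂ := fderiv ℂ (derivSnd p) x (1, 0)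

lemma analyticAt_derivSnd {p : ℂ × ℂ → ℂ} {x : ℂ × ℂ} (h : AnalyticAt ℂ p x) :
    AnalyticAt ℂ (derivSnd p) x :=
  ((ContinuousLinearMap.apply ℂ ℂ ((0, 1) : ℂ × ℂ)).analyticAt _).comp h.fderiv

lemma analyticAt_derivMixed {p : ℂ × ℂ → ℂ} {x : ℂ × ℂ} (h : AnalyticAt ℂ p x) :
    AnalyticAt ℂ (derivMixed p) x :=
  ((ContinuousLinearMap.apply ℂ ℂ ((1, 0) : ℂ × ℂ)).analyticAt _).comp
    (analyticAt_derivSnd h).fderiv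

lemma hasDerivAt_slice_fst {p : ℂ × ℂ → ℂ} {a b : ℂ} (h : DifferentiableAt ℂ p (a, b)) :
    HasDerivAt (fun a => p (a, b)) (fderiv ℂ p (a, b) (1, 0)) a :=
  h.hasFDerivAt.comp_hasDerivAt a ((hasDerivAt_id a).prodMk (hasDerivAt_const a b))

lemma hasDerivAt_slice_snd {p : ℂ × ℂ → ℂ} {a b : ℂ} (h : DifferentiableAt ℂ p (a, b)) :
    HasDerivAt (fun b => p (a, b)) (derivSnd p (a, b)) b :=
  h.hasFDerivAt.comp_hasDerivAt b ((hasDerivAt_const b a).prodMk (hasDerivAt_id b))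

lemma dz_eq_of_hasDerivAt {f : ℂ → ℂ} {f' z : ℂ} (h : HasDerivAt f f' z) : dz f z = f' := by
  have h2 : HasFDerivAt (fun x : ℂ × ℂ => f x.1) _ (z, conj z) :=
    HasFDerivAt.comp (g := f) (z, conj z) h.hasFDerivAt (ContinuousLinearMap.fst ℂ ℂ ℂ).hasFDerivAt
  have h3 := dz_comp_conj (Ψ := fun x => f x.1) h2.differentiableAt
  rw [h2.fderiv] at h3
  simpa using h3

lemma dbar_conj_eq_of_hasDerivAt {f : ℂ → ℂ} {f' z : ℂ} (h : HasDerivAt f f' (conj z)) :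
    dbar (fun w => f (conj w)) z = f' := by
  have h2 : HasFDerivAt (fun x : ℂ × ℂ => f x.2) _ (z, conj z) :=
    HasFDerivAt.comp (g := f) (z, conj z) h.hasFDerivAt (ContinuousLinearMap.snd ℂ ℂ ℂ).hasFDerivAt
  have h3 := dbar_comp_conj (Ψ := fun x => f x.2) h2.differentiableAt
  rw [h2.fderiv] at h3
  simpa using h3

/-! ### Mean value estimates from a nearly constant mixed derivative -/

section MeanValue

variable {p : ℂ × ℂ → ℂ} {U V : Set ℂ} {d : ℂ} {η : ℝ}

lemma norm_derivSnd_sub_le (hU : Convex ℝ U) (hp : AnalyticOnNhd ℂ p (U ×ˢ V))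
    (hd : ∀ x ∈ U ×ˢ V, ‖derivMixed p x - d‖ ≤ η) {a a' b : ℂ} (ha : a ∈ U) (ha' : a' ∈ U)
    (hb : b ∈ V) :
    ‖derivSnd p (a, b) - derivSnd p (a', b) - d * (a - a')‖ ≤ η * ‖a - a'‖ := by
  have h := hU.norm_image_sub_le_of_norm_hasDerivWithin_le
    (f := fun a => derivSnd p (a, b) - d * a) (f' := fun a => derivMixed p (a, b) - d * 1)
    (C := η) (fun x hx => ?_) (fun x hx => by simpa using hd (x, b) ⟨hx, hb⟩) ha' ha
  · refine (congrArg norm ?_).trans_le h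
    ring
  · have h1 : HasDerivAt (fun a => derivSnd p (a, b)) (derivMixed p (x, b)) x :=
      hasDerivAt_slice_fst (analyticAt_derivSnd (hp (x, b) ⟨hx, hb⟩)).differentiableAt
    exact (h1.sub ((hasDerivAt_id x).const_mul d)).hasDerivWithinAt

/-- Subtracting the model $d\,ab$ leaves a function whose mixed derivative is at most $\eta$ in
norm; the mean value inequality is then used once in each variable. -/
lemma norm_second_difference_sub_le (hU : Convex ℝ U) (hV : Convex ℝ V)
    (hp : AnalyticOnNhd ℂ p (U ×ˢ V)) (hd : ∀ x ∈ U ×ˢ V, ‖derivMixed p x - d‖ ≤ η)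
    {a a' b b' : ℂ} (ha : a ∈ U) (ha' : a' ∈ U) (hb : b ∈ V) (hb' : b' ∈ V) :
    ‖p (a, b) - p (a', b) - p (a, b') + p (a', b') - d * ((a - a') * (b - b'))‖ ≤
      η * ‖a - a'‖ * ‖b - b'‖ := by
  have h := hV.norm_image_sub_le_of_norm_hasDerivWithin_le
    (f := fun b => p (a, b) - p (a', b) - d * (a - a') * b)
    (f' := fun b => derivSnd p (a, b) - derivSnd p (a', b) - d * (a - a') * 1)
    (C := η * ‖a - a'‖) (fun y hy => ?_)
    (fun y hy => by simpa using norm_derivSnd_sub_le hU hp hd ha ha' hy) hb' hb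
  · refine (congrArg norm ?_).trans_le h
    ring
  · have h1 := hasDerivAt_slice_snd (hp (a, y) ⟨ha, hy⟩).differentiableAt
    have h2 := hasDerivAt_slice_snd (hp (a', y) ⟨ha', hy⟩).differentiableAt
    exact ((h1.sub h2).sub ((hasDerivAt_id y).const_mul _)).hasDerivWithinAt

end MeanValue

lemma half_le_re_of_norm_sub_le {x d : ℂ} {c : ℝ} (h : ‖x - d‖ ≤ c / 2) (hd : d.re = c) :
    c / 2 ≤ x.re := by
  have := (abs_le.1 ((Complex.abs_re_le_norm (x - d)).trans h)).1
  rw [Complex.sub_re, hd] at this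
  linarith

/-! ### Verification of the admissibility conditions -/

section Admissible

variable {Q : ℂ → ℝ} {z₀ : ℂ} {r : ℝ} {p : ℂ × ℂ → ℂ}

lemma isPolarization_of_holomorphic
    (hp : AnalyticOnNhd ℂ p (Metric.ball z₀ r ×ˢ Metric.ball (conj z₀) r))
    (hdiag : ∀ w ∈ Metric.ball z₀ r, p (w, conj w) = Q w) :
    IsPolarization Q z₀ r fun z w => p (z, conj w) :=
  ⟨by simpa using hp, hdiag⟩

lemma dbar_eq_derivSnd (hp : AnalyticOnNhd ℂ p (Metric.ball z₀ r ×ˢ Metric.ball (conj z₀) r))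
    (hdiag : ∀ w ∈ Metric.ball z₀ r, p (w, conj w) = Q w) {w : ℂ} (hw : w ∈ Metric.ball z₀ r) :
    dbar (fun η => (Q η : ℂ)) w = derivSnd p (w, conj w) := by
  rw [← dbar_eqOn Metric.isOpen_ball hdiag hw]
  exact dbar_comp_conj (hp _ ⟨hw, conj_mem_ball hw⟩).differentiableAt

lemma lap_eq_re_derivMixed
    (hp : AnalyticOnNhd ℂ p (Metric.ball z₀ r ×ˢ Metric.ball (conj z₀) r))
    (hdiag : ∀ w ∈ Metric.ball z₀ r, p (w, conj w) = Q w) {z : ℂ} (hz : z ∈ Metric.ball z₀ r) :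
    lap Q z = (derivMixed p (z, conj z)).re := by
  rw [lap, dz_congr (g := fun w => derivSnd p (w, conj w))]
  · rw [dz_comp_conj (analyticAt_derivSnd (hp _ ⟨hz, conj_mem_ball hz⟩)).differentiableAt]
    rfl
  · filter_upwards [Metric.isOpen_ball.mem_nhds hz] with w hw using dbar_eq_derivSnd hp hdiag hw

/-- Off the diagonal $\bar\partial_w\theta=(\partial_bp(w,\bar w)-\partial_bp(z,\bar w))/(w-z)$, a
difference quotient governed by the mixed derivative. The diagonal value follows by continuity of
$\bar\partial_w\theta$. -/
lemma norm_dbar_phase_sub_le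
    (hp : AnalyticOnNhd ℂ p (Metric.ball z₀ r ×ˢ Metric.ball (conj z₀) r))
    (hdiag : ∀ w ∈ Metric.ball z₀ r, p (w, conj w) = Q w) {d : ℂ} {c : ℝ}
    (hd : ∀ x ∈ Metric.ball z₀ r ×ˢ Metric.ball (conj z₀) r, ‖derivMixed p x - d‖ ≤ c) {z w : ℂ}
    (hz : z ∈ Metric.ball z₀ r) (hw : w ∈ Metric.ball z₀ r) :
    ‖dbar (phase Q (fun z w => p (z, conj w)) z) w - d‖ ≤ c := by
  have hball : IsOpen (Metric.ball z₀ r) := Metric.isOpen_ball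
  -- off the diagonal
  have off : ∀ w ∈ Metric.ball z₀ r, w ≠ z →
      ‖dbar (phase Q (fun z w => p (z, conj w)) z) w - d‖ ≤ c := by
    intro w hw hwz
    have hwz' : w - z ≠ 0 := sub_ne_zero.2 hwz
    have h1 : phase Q (fun z w => p (z, conj w)) z =ᶠ[𝓝 w]
        fun η => (η - z)⁻¹ * (p (η, conj η) - p (z, conj η)) := by
      filter_upwards [hball.mem_nhds hw, isOpen_ne.mem_nhds hwz] with η hη hηz
      rw [phase, if_neg hηz, hdiag η hη, div_eq_inv_mul]
    have hinv : DifferentiableAt ℂ (fun η : ℂ => (η - z)⁻¹) w :=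
      DifferentiableAt.fun_inv (by fun_prop) hwz'
    have hpd := (hp (w, conj w) ⟨hw, conj_mem_ball hw⟩).differentiableAt
    have hpz := hasDerivAt_slice_snd (hp (z, conj w) ⟨hz, conj_mem_ball hw⟩).differentiableAt
    have d1 : DifferentiableAt ℝ (fun η => p (η, conj η)) w :=
      (hasFDerivAt_comp_conj hpd.hasFDerivAt).differentiableAt
    have d2 : DifferentiableAt ℝ (fun η => (-1) * p (z, conj η)) w :=
      (DifferentiableAt.comp (g := fun b => p (z, b)) w (hpz.differentiableAt.restrictScalars ℝ)
        (hasFDerivAt_conj w).differentiableAt).const_mul _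
    have d2' : DifferentiableAt ℝ (fun η => p (z, conj η)) w :=
      DifferentiableAt.comp (g := fun b => p (z, b)) w (hpz.differentiableAt.restrictScalars ℝ)
        (hasFDerivAt_conj w).differentiableAt
    have h2 : dbar (fun η => p (η, conj η) - p (z, conj η)) w =
        derivSnd p (w, conj w) - derivSnd p (z, conj w) := by
      have hfun : (fun η => p (η, conj η) - p (z, conj η)) =
          fun η => p (η, conj η) + (-1) * p (z, conj η) := by ext; ring
      rw [hfun, dbar_add d1 d2, dbar_const_mul _ d2', dbar_comp_conj hpd,
        dbar_conj_eq_of_hasDerivAt hpz]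
      simp only [derivSnd]
      ring
    rw [dbar_congr h1, dbar_mul (hinv.restrictScalars ℝ) (d1.fun_sub d2'),
      dbar_eq_zero_of_differentiableAt hinv, h2, zero_mul, zero_add]
    have h3 := norm_derivSnd_sub_le (convex_ball z₀ r) hp hd hw hz (conj_mem_ball hw)
    have h4 : (w - z)⁻¹ * (derivSnd p (w, conj w) - derivSnd p (z, conj w)) - d =
        (w - z)⁻¹ * (derivSnd p (w, conj w) - derivSnd p (z, conj w) - d * (w - z)) := by
      field_simp
    rw [h4, norm_mul, norm_inv, inv_mul_le_iff₀ (norm_pos_iff.2 hwz'), mul_comm ‖w - z‖ c]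
    exact h3
  by_cases hwz : w = z
  · subst hwz
    have hcont : ContinuousAt (dbar (phase Q (fun z w => p (z, conj w)) w)) w :=
      ((isPolarization_of_holomorphic hp hdiag).isTriholomorphic_phase.dbar_right.contDiffOn_right
        hz).continuousOn.continuousAt (hball.mem_nhds hz)
    have ht : Tendsto (fun η => ‖dbar (phase Q (fun z w => p (z, conj w)) w) η - d‖) (𝓝[≠] w)
        (𝓝 ‖dbar (phase Q (fun z w => p (z, conj w)) w) w - d‖) :=
      ((hcont.tendsto.sub_const d).norm).mono_left nhdsWithin_le_nhds
    refine le_of_tendsto ht ?_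
    filter_upwards [self_mem_nhdsWithin, mem_nhdsWithin_of_mem_nhds (hball.mem_nhds hz)] with η h h'
    exact off η h' h
  · exact off w hw hwz

/-- With error at most $\frac12\Delta Q(z_0)$, both $\partial_a\partial_bp$ and
$\bar\partial_w\theta$ have real part at least $\frac12\Delta Q(z_0)$ and so cannot vanish. For (4),
the symmetry of $p$ makes the real part of its second difference over $z,w$ and $\bar z,\bar w$
equal to $Q(z)+Q(w)-2\operatorname{Re}Q(z,w)$, which lies within $\frac12\Delta Q(z_0)|z-w|^2$ of
$\Delta Q(z_0)|z-w|^2$. -/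
lemma isAdmissible_of_holomorphic (hr : 0 < r) (hpos : 0 < lap Q z₀)
    (hQ : AnalyticOnNhd ℝ Q (Metric.ball z₀ r))
    (hp : AnalyticOnNhd ℂ p (Metric.ball z₀ r ×ˢ Metric.ball (conj z₀) r))
    (hdiag : ∀ w ∈ Metric.ball z₀ r, p (w, conj w) = Q w)
    (hsymm : ∀ a b, conj (p (a, b)) = p (conj b, conj a))
    (hd : ∀ x ∈ Metric.ball z₀ r ×ˢ Metric.ball (conj z₀) r,
      ‖derivMixed p x - derivMixed p (z₀, conj z₀)‖ ≤ lap Q z₀ / 2) :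
    IsAdmissible Q z₀ r fun z w => p (z, conj w) := by
  have hre : (derivMixed p (z₀, conj z₀)).re = lap Q z₀ :=
    (lap_eq_re_derivMixed hp hdiag (Metric.mem_ball_self hr)).symm
  -- A quarter rather than a half, because the lower bound on the Laplacian must be strict.
  refine ⟨hr, hQ, ⟨lap Q z₀ / 4, by positivity, fun z hz => ?_⟩,
    isPolarization_of_holomorphic hp hdiag, fun z hz w hw => ?_, fun z hz w hw h0 => ?_,
    fun z hz w hw => ?_⟩
  · rw [lap_eq_re_derivMixed hp hdiag hz]
    have := half_le_re_of_norm_sub_le (hd (z, conj z) ⟨hz, conj_mem_ball hz⟩) hre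
    linarith
  · have h1 : (fun ζ => dbar (fun η => p (ζ, conj η)) w) =ᶠ[𝓝 z]
        fun ζ => derivSnd p (ζ, conj w) := by
      filter_upwards [Metric.isOpen_ball.mem_nhds hz] with ζ hζ
      exact dbar_conj_eq_of_hasDerivAt
        (hasDerivAt_slice_snd (hp (ζ, conj w) ⟨hζ, conj_mem_ball hw⟩).differentiableAt)
    have h2 : HasDerivAt (fun ζ => derivSnd p (ζ, conj w)) (derivMixed p (z, conj w)) z :=
      hasDerivAt_slice_fst
        (analyticAt_derivSnd (hp (z, conj w) ⟨hz, conj_mem_ball hw⟩)).differentiableAt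
    rw [dz_congr h1, dz_eq_of_hasDerivAt h2]
    intro h0
    have := half_le_re_of_norm_sub_le (hd (z, conj w) ⟨hz, conj_mem_ball hw⟩) hre
    rw [h0, Complex.zero_re] at this
    linarith
  · have := half_le_re_of_norm_sub_le (norm_dbar_phase_sub_le hp hdiag hd hz hw) hre
    have h0' : dbar (phase Q (fun z w => p (z, conj w)) z) w = 0 := h0
    rw [h0', Complex.zero_re] at this
    linarith
  · have h := norm_second_difference_sub_le (convex_ball z₀ r) (convex_ball (conj z₀) r) hp hd hz hw
      (conj_mem_ball hz) (conj_mem_ball hw)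
    rw [← map_sub, Complex.norm_conj, Complex.mul_conj, hdiag z hz, hdiag w hw] at h
    have h1 := (abs_le.1 ((Complex.abs_re_le_norm _).trans h)).1
    have hs : (p (w, conj z)).re = (p (z, conj w)).re := by
      have := congrArg Complex.re (hsymm z (conj w))
      rw [Complex.conj_re, Complex.conj_conj] at this
      exact this.symm
    simp only [Complex.sub_re, Complex.add_re, Complex.re_mul_ofReal, Complex.ofReal_re, hs, hre,
      Complex.normSq_eq_norm_sq] at h1
    rw [norm_sub_rev w z]
    linarith

lemma exists_isAdmissible (han : AnalyticAt ℝ Q z₀) (hpos : 0 < lap Q z₀) :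
    ∃ r₀ : ℝ, 0 < r₀ ∧ ∀ r : ℝ, 0 < r → r ≤ r₀ → ∃ P : ℂ → ℂ → ℂ, IsAdmissible Q z₀ r P := by
  obtain ⟨p, hp, hdiag, hsymm⟩ := exists_holomorphic_extension han
  have hd : ∀ᶠ x in 𝓝 (z₀, conj z₀),
      ‖derivMixed p x - derivMixed p (z₀, conj z₀)‖ ≤ lap Q z₀ / 2 := by
    have := (analyticAt_derivMixed hp).continuousAt.eventually
      (Metric.closedBall_mem_nhds _ (half_pos hpos))
    filter_upwards [this] with x hx
    simpa [dist_eq_norm] using hx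
  obtain ⟨r₁, hr₁, h₁⟩ := Metric.eventually_nhds_iff_ball.1 (hp.eventually_analyticAt.and hd)
  obtain ⟨r₂, hr₂, h₂⟩ := Metric.eventually_nhds_iff_ball.1 (han.eventually_analyticAt.and hdiag)
  refine ⟨min r₁ r₂, lt_min hr₁ hr₂, fun r hr hle => ⟨_, isAdmissible_of_holomorphic (p := p) hr hpos
    (fun w hw => ?_) (fun x hx => ?_) (fun w hw => ?_) hsymm (fun x hx => ?_)⟩⟩
  · exact (h₂ w (Metric.ball_subset_ball (hle.trans (min_le_right _ _)) hw)).1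
  · rw [ball_prod_same] at hx
    exact (h₁ x (Metric.ball_subset_ball (hle.trans (min_le_left _ _)) hx)).1
  · exact (h₂ w (Metric.ball_subset_ball (hle.trans (min_le_right _ _)) hw)).2
  · rw [ball_prod_same] at hx
    exact (h₁ x (Metric.ball_subset_ball (hle.trans (min_le_left _ _)) hx)).2

end Admissible

end Polyanalytic

end

theorem mainTheorem5 (Q : ℂ → ℝ) (hQ : Continuous Q) (z₀ : ℂ)
    (han : AnalyticAt ℝ Q z₀) (hpos : 0 < Polyanalytic.lap Q z₀) :
    -- all sufficiently small radii are admissible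
    (∃ r₀ : ℝ, 0 < r₀ ∧ ∀ r : ℝ, 0 < r → r ≤ r₀ →
      ∃ P : ℂ → ℂ → ℂ, Polyanalytic.IsAdmissible Q z₀ r P) ∧
    ∀ (r : ℝ) (P : ℂ → ℂ → ℂ), Polyanalytic.IsAdmissible Q z₀ r P →
      ∀ q : ℕ, 1 ≤ q →
        -- the kernel is `q`-analytic in the first variable and real-analytic in the second
        (∀ m : ℝ, 1 ≤ m →
          (∀ w ∈ Metric.ball z₀ r,
            Polyanalytic.IsPolyanalyticOn q (fun z => Polyanalytic.kernelR q m Q P z w)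
              (Metric.ball z₀ r)) ∧
          (∀ z ∈ Metric.ball z₀ r,
            AnalyticOnNhd ℝ (fun w => Polyanalytic.kernelR q m Q P z w)
              (Metric.ball z₀ r))) ∧
        -- the approximate reproducing identity
        ∀ χ₀ : ℝ → ℝ, Polyanalytic.IsCutoff χ₀ →
          ∃ δ : ℝ, 0 < δ ∧ ∃ C : ℝ, 0 < C ∧ ∀ m : ℝ, 1 ≤ m → ∀ u : ℂ → ℂ, Polyanalytic.MemA2 q m Q u →
            ∀ z ∈ Metric.ball z₀ (r / 3),
              MeasureTheory.IntegrableOn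
                (fun w => u w * (χ₀ (‖w - z₀‖ / r) : ℂ) * Polyanalytic.kernelR q m Q P z w *
                  Polyanalytic.expPhase m Q P z w)
                (Metric.ball z₀ r) Polyanalytic.area ∧
              ‖u z - ∫ w in Metric.ball z₀ r,
                  u w * (χ₀ (‖w - z₀‖ / r) : ℂ) * Polyanalytic.kernelR q m Q P z w *
                    Polyanalytic.expPhase m Q P z w ∂Polyanalytic.area‖
                ≤ C * Polyanalytic.wnorm m Q u * Real.exp (m * Q z / 2 - δ * m) := by
  refine ⟨Polyanalytic.exists_isAdmissible han hpos, fun r P hA q hq =>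
    ⟨fun m _ => ⟨fun w hw => hA.polar.isPolyanalyticOn_kernelR q m hw,
      fun z hz => hA.polar.analyticOnNhd_kernelR q m hz⟩, fun χ₀ hχ => ?_⟩⟩
  obtain ⟨n, rfl⟩ : ∃ n, q = n + 1 := ⟨q - 1, by omega⟩
  exact hA.approximate_reproducing hQ hpos n hχ
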